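/- A digraph here is finite, has no loops and no multiple arcs (two opposite arcs $uv$ and $vu$ are allowed). The length of a directed cycle is its number of arcs, so cycle lengths are at least $2$. For a set $L$ of positive integers, an $L$-cycle digraph is a digraph all of whose directed cycles have length in $L$, and $\vec c(L,n)$ is the maximum number of directed cycles in an $n$-vertex $L$-cycle digraph. Theorem. For all integers $2\le k\le n$, \[ \vec c(\{k\},n)=\prod_{i=0}^{k-2}\left\lfloor\frac{n-1+i}{k-1}\right\rfloor . \] Moreover, if $k\ge 3$, then an $n$-vertex digraph is a $\{k\}$-cycle digraph with exactly $\vec c(\{k\},n)$ directed cycles if and only if its vertex set can be partitioned into classes $V_0,\dots,V_{k-1}$ with $|V_0|=1$ and $|V_i|\in\left\{\left\lfloor\frac{n-1}{k-1}\right\rfloor,\left\lceil\frac{n-1}{k-1}\right\rceil\right\}$ for $1\le i\le k-1$, such that its arcs are exactly all pairs $uv$ with $u\in V_i$ and $v\in V_{i+1}$ for some $i$ (indices modulo $k$). If $k=2$, then an $n$-vertex digraph is a $\{2\}$-cycle digraph with exactly $\vec c(\{2\},n)=n-1$ directed cycles if and only if it is obtained from a tree on its $n$ vertices by replacing each edge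 with two opposite arcs. -/

import Mathlib

/-- `G` has no loops. (Multiple arcs cannot occur in `Digraph`; a pair of opposite arcs can.) -/
def Digraph.NoLoops {V : Type*} (G : Digraph V) : Prop :=
  ∀ v, ¬ G.Adj v v

/-- `C` is a directed cycle of `G`: a nonempty cyclic sequence of distinct vertices (a list up to
rotation) in which there is an arc from each vertex to the next one, cyclically.
Its length `C.length` is its number of arcs. -/
def Digraph.IsDicycle {V : Type*} (G : Digraph V) (C : Cycle V) : Prop :=
  C ≠ Cycle.nil ∧ C.Nodup ∧ C.Chain G.Adj

/-- The number of directed cycles of `G` (used for digraphs on finite vertex sets). -/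
noncomputable def Digraph.numDicycles {V : Type*} (G : Digraph V) : ℕ :=
  {C : Cycle V | G.IsDicycle C}.ncard

/-- `G` is an `L`-cycle digraph: it has no loops and all its cycle lengths belong to `L`. -/
def Digraph.IsLCycleDigraph {V : Type*} (G : Digraph V) (L : Set ℕ) : Prop :=
  G.NoLoops ∧ ∀ C : Cycle V, G.IsDicycle C → C.length ∈ L

/-- The maximum number of directed cycles in an `n`-vertex `L`-cycle digraph. -/
noncomputable def maxDicycles (L : Set ℕ) (n : ℕ) : ℕ :=
  sSup {m : ℕ | ∃ G : Digraph (Fin n), G.IsLCycleDigraph L ∧ G.numDicycles = m}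

/-- `G` attains the maximum number of directed cycles among the `L`-cycle digraphs with the
same number of vertices. -/
def Digraph.IsExtremal {V : Type*} [Fintype V] (G : Digraph V) (L : Set ℕ) : Prop :=
  G.IsLCycleDigraph L ∧ G.numDicycles = maxDicycles L (Fintype.card V)

/-- `G` is a balanced blow-up of a directed `k`-cycle in which one class is a single vertex:
the vertices are distributed into classes indexed by `ℤ/k`, where class `0` is a single vertex,
each other class has size the floor or the ceiling of `(|V| - 1) / (k - 1)`, and the arcs are
exactly the pairs going from a class to the cyclically next one. -/
def Digraph.IsBalancedBlowup {V : Type*} [Fintype V] (G : Digraph V) (k : ℕ) : Prop :=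
  ∃ c : V → ZMod k,
    {v | c v = 0}.ncard = 1 ∧
    (∀ i : ZMod k, i ≠ 0 →
      {v | c v = i}.ncard = (Fintype.card V - 1) / (k - 1) ∨
      {v | c v = i}.ncard = (Fintype.card V - 1) ⌈/⌉ (k - 1)) ∧
    ∀ u v, G.Adj u v ↔ c v = c u + 1

/-- `G` arises from a tree on its vertex set by replacing each edge with two opposite arcs. -/
def Digraph.IsDoubledTree {V : Type*} (G : Digraph V) : Prop :=
  ∃ T : SimpleGraph V, T.IsTree ∧ ∀ u v, G.Adj u v ↔ T.Adj u v

/-- A digraph on a finite vertex set has finitely many directed cycles. -/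
theorem Digraph.finite_dicycles {V : Type*} [Finite V] (G : Digraph V) :
    {C : Cycle V | G.IsDicycle C}.Finite := by
  classical
  have := Fintype.ofFinite V
  have hf : Finite {C : Cycle V // C.Nodup} := inferInstance
  exact (Set.finite_coe_iff.mp hf : {C : Cycle V | C.Nodup}.Finite).subset fun C hC => hC.2.1

/-- The maximum in the definition of `maxDicycles` is attained. -/
theorem isGreatest_maxDicycles (L : Set ℕ) (n : ℕ) :
    IsGreatest {m : ℕ | ∃ G : Digraph (Fin n), G.IsLCycleDigraph L ∧ G.numDicycles = m}
      (maxDicycles L n) := by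
  set S := {m : ℕ | ∃ G : Digraph (Fin n), G.IsLCycleDigraph L ∧ G.numDicycles = m} with hS
  have hb : BddAbove S := by
    refine (Set.Finite.subset (Set.finite_range
      (fun G : Digraph (Fin n) => G.numDicycles)) ?_).bddAbove
    rintro m ⟨G, -, rfl⟩
    exact ⟨G, rfl⟩
  have hne : S.Nonempty := by
    refine ⟨_, ⊥, ⟨fun v h => h, fun C hC => ?_⟩, rfl⟩
    obtain ⟨h0, -, h2⟩ := hC
    induction C using Cycle.induction_on with
    | nil => exact absurd rfl h0
    | cons a l _ =>
      cases l with
      | nil => exact absurd h2 (by simp)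
      | cons b l => exact absurd h2 (by simp [Cycle.chain_coe_cons])
  exact ⟨Nat.sSup_mem hne hb, fun m hm => le_csSup hb hm⟩

/-! If every directed cycle has length `k`, every closed walk has length divisible by `k`. Hence the
arcs lying on closed walks, which carry all directed cycles, respect a colouring by ℤ/k that
increases by 1 along each arc (`exists_isGraded_cyclicPart`). Directed cycles then correspond to the
transversals of the colour classes that close up cyclically.

Let `p` be the size of class 0 and `q` the least size of another class. Shift a transversal `x`
inside the classes so as to get `q` translates that are disjoint outside class 0. Join a vertex `w`
of class 0 to a translate when `w` closes it to a directed cycle. A cycle in this bipartite graph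
would splice into a directed cycle longer than `k`, so the graph is a forest with at most `p + q -
1` edges (`isAcyclic_closingGraph`). Summing over all `x` counts each directed cycle `p * q` times,
so their number is at most `p + q - 1` times the product of the remaining class sizes
(`card_cyclicTuple_le`). These are `k - 1` factors with sum `n - 1`, and the balanced product bounds
them.

In the equality case with `k ≥ 3` all these forests are trees. If every class had two vertices,
exchanging one vertex between two disjoint transversals would give a directed cycle of length `2 *
k` (`false_of_card_closings_eq`). So some class is a singleton, all transversals are directed
cycles, and the other classes are balanced. For `k = 2` the directed cycles are the edges of a
forest, the graph of opposite arc pairs. -/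

namespace Digraph

/-! ### Directed cycles as functions on ℤ/m. -/

variable {V : Type*}

/-- The cyclic sequence `f 0, f 1, …, f (m - 1)`. -/
def cycleOfFn {m : ℕ} (f : ZMod m → V) : Cycle V :=
  ((List.range m).map fun i : ℕ => f (i : ZMod m) : List V)

theorem length_cycleOfFn {m : ℕ} (f : ZMod m → V) : (cycleOfFn f).length = m := by
  simp [cycleOfFn]

theorem mem_cycleOfFn {m : ℕ} [NeZero m] (f : ZMod m → V) (v : V) :
    v ∈ cycleOfFn f ↔ ∃ i, f i = v := by
  simp only [cycleOfFn, Cycle.mem_coe_iff, List.mem_map, List.mem_range]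
  constructor
  · rintro ⟨i, -, h⟩
    exact ⟨_, h⟩
  · rintro ⟨i, h⟩
    exact ⟨i.val, ZMod.val_lt i, by simpa using h⟩

theorem isDicycle_cycleOfFn (G : Digraph V) {m : ℕ} [NeZero m] {f : ZMod m → V}
    (hf : Function.Injective f) (hadj : ∀ i, G.Adj (f i) (f (i + 1))) :
    G.IsDicycle (cycleOfFn f) := by
  obtain ⟨m, rfl⟩ := Nat.exists_eq_succ_of_ne_zero (NeZero.ne m)
  refine ⟨?_, ?_, ?_⟩
  · intro h
    have := length_cycleOfFn f
    rw [h] at this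
    simp at this
  · simp only [cycleOfFn, Cycle.nodup_coe_iff]
    refine List.Nodup.map_on ?_ List.nodup_range
    intro x hx y hy hxy
    have h := hf hxy
    rw [ZMod.natCast_eq_natCast_iff'] at h
    rw [List.mem_range] at hx hy
    rwa [Nat.mod_eq_of_lt hx, Nat.mod_eq_of_lt hy] at h
  · have : cycleOfFn f = (List.range m.succ : Cycle ℕ).map fun i : ℕ => f (i : ZMod m.succ) := rfl
    rw [this, Cycle.chain_map, Cycle.chain_range_succ]
    refine ⟨?_, fun i _ => by simpa using hadj i⟩
    have h := hadj (m : ZMod m.succ)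
    have h0 : (m : ZMod m.succ) + 1 = 0 := by
      have := ZMod.natCast_self m.succ
      push_cast at this
      exact this
    rw [h0] at h
    simpa using h

theorem IsDicycle.exists_eq_cycleOfFn {G : Digraph V} {C : Cycle V} (hC : G.IsDicycle C) :
    C.length ≠ 0 ∧ ∃ f : ZMod C.length → V, Function.Injective f ∧
      (∀ i, G.Adj (f i) (f (i + 1))) ∧ cycleOfFn f = C := by
  obtain ⟨h0, h1, h2⟩ := hC
  induction C using Cycle.induction_on with
  | nil => exact absurd rfl h0
  | cons a l _ =>
    refine ⟨by simp, ?_⟩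
    set L := a :: l with hL
    have hlen : (L : Cycle V).length = l.length + 1 := by simp [hL]
    have key : ∃ f : ZMod (l.length + 1) → V, Function.Injective f ∧
        (∀ i, G.Adj (f i) (f (i + 1))) ∧ cycleOfFn f = (L : Cycle V) := by
      let f : ZMod (l.length + 1) → V := fun i => L[i.val]'(by simpa [hL] using ZMod.val_lt i)
      have hmap : (List.range (l.length + 1)).map (fun i : ℕ => f (i : ZMod (l.length + 1))) = L := by
        apply List.ext_getElem
        · simp [hL]
        · intro i hi hi'
          have : i < l.length + 1 := by simpa using hi
          simp only [List.getElem_map, List.getElem_range, f]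
          congr 1
          rw [ZMod.val_natCast, Nat.mod_eq_of_lt this]
      refine ⟨f, ?_, ?_, ?_⟩
      · intro i j hij
        have := (List.Nodup.getElem_inj_iff (Cycle.nodup_coe_iff.1 h1)).1 hij
        exact ZMod.val_injective _ this
      · have h3 : (L : Cycle V) =
            (List.range (l.length + 1) : Cycle ℕ).map fun i : ℕ => f (i : ZMod (l.length + 1)) := by
          rw [Cycle.map_coe, hmap]
        rw [h3, Cycle.chain_map, Cycle.chain_range_succ] at h2
        intro i
        have hi := ZMod.val_lt i
        have hv : ((i.val : ℕ) : ZMod (l.length + 1)) = i := by simp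
        rcases Nat.lt_succ_iff_lt_or_eq.1 hi with h | h
        · have := h2.2 _ h
          rw [Nat.succ_eq_add_one, Nat.cast_add, hv] at this
          simpa using this
        · have := h2.1
          have hl : ((l.length : ℕ) : ZMod (l.length + 1)) = i := (congrArg Nat.cast h).symm.trans hv
          have h0 : i + 1 = 0 := by
            rw [← hl]
            have := ZMod.natCast_self (l.length + 1)
            push_cast at this
            exact this
          rw [hl] at this
          rw [h0]
          simpa using this
      · simp only [cycleOfFn, hmap]
    rw [hlen]
    exact key

/-- A cycle is unchanged by a shift of its parametrization. -/
theorem cycleOfFn_add_right {m : ℕ} [NeZero m] (f : ZMod m → V) (a : ZMod m) :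
    cycleOfFn (fun i => f (i + a)) = cycleOfFn f := by
  simp only [cycleOfFn, Cycle.coe_eq_coe]
  refine List.IsRotated.symm ⟨a.val, ?_⟩
  apply List.ext_getElem
  · simp
  · intro i hi hi'
    simp [List.getElem_rotate]

theorem IsDicycle.mono {G H : Digraph V} (h : ∀ u v, G.Adj u v → H.Adj u v) {C : Cycle V}
    (hC : G.IsDicycle C) : H.IsDicycle C :=
  ⟨hC.1, hC.2.1, hC.2.2.imp h⟩

/-- The concatenation of a cyclic sequence of nonempty directed paths, each followed by an arc to
the beginning of the next one, is a directed cycle if no vertex is repeated. -/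
theorem isDicycle_flatten (G : Digraph V) {L : List (List V)} (hL : L ≠ []) (hne : [] ∉ L)
    (hnd : L.flatten.Nodup) (hch : ∀ l ∈ L, l.IsChain G.Adj)
    (hcyc : Cycle.Chain (fun l₁ l₂ : List V => ∀ x ∈ l₁.getLast?, ∀ y ∈ l₂.head?, G.Adj x y) L) :
    G.IsDicycle (L.flatten : List V) := by
  refine ⟨?_, by simpa using hnd, ?_⟩
  · intro h
    rw [Cycle.coe_eq_nil, List.flatten_eq_nil_iff] at h
    cases L with
    | nil => exact hL rfl
    | cons l L => exact hne (by simp [h l (by simp)])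
  · match L, hL with
    | [] :: L, _ => exact absurd (by simp) hne
    | (a :: l) :: L, _ =>
      have : ((a :: l) :: L).flatten = a :: (l ++ L.flatten) := by simp
      rw [this, Cycle.chain_coe_cons]
      -- The repeated first vertex becomes an extra block `[a]`, which turns the cyclic condition
      -- into a linear one on blocks.
      have h2 : a :: (l ++ L.flatten ++ [a]) = (((a :: l) :: L) ++ [[a]]).flatten := by simp
      rw [h2, List.isChain_flatten (by simpa using hne)]
      refine ⟨?_, ?_⟩
      · intro l' hl'
        rw [List.mem_append, List.mem_singleton] at hl'
        rcases hl' with h | rfl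
        · exact hch _ h
        · simp
      · rw [Cycle.chain_coe_cons, ← List.cons_append, List.isChain_append] at hcyc
        rw [List.isChain_append]
        refine ⟨hcyc.1, by simp, ?_⟩
        intro x hx y hy
        have := hcyc.2.2 x hx (a :: l) (by simp)
        simp only [List.head?_cons, Option.mem_some_iff] at hy
        subst hy
        simpa using this

end Digraph

/-! ### Closed walks and the colouring by ℤ/k. -/

namespace Digraph

variable {V : Type*}

/-- There is a directed walk with `n` arcs from `u` to `v`. -/
def HasWalk (G : Digraph V) (n : ℕ) (u v : V) : Prop :=
  ∃ f : ℕ → V, f 0 = u ∧ f n = v ∧ ∀ i < n, G.Adj (f i) (f (i + 1))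

theorem HasWalk.refl (G : Digraph V) (u : V) : G.HasWalk 0 u u :=
  ⟨fun _ => u, rfl, rfl, by simp⟩

theorem HasWalk.of_adj {G : Digraph V} {u v : V} (h : G.Adj u v) : G.HasWalk 1 u v :=
  ⟨fun i => if i = 0 then u else v, by simp, by simp, by simpa using h⟩

theorem HasWalk.trans {G : Digraph V} {m n : ℕ} {u v w : V} (h : G.HasWalk m u v)
    (h' : G.HasWalk n v w) : G.HasWalk (m + n) u w := by
  obtain ⟨f, rfl, rfl, hf⟩ := h
  obtain ⟨g, hg0, rfl, hg⟩ := h'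
  refine ⟨fun i => if i ≤ m then f i else g (i - m), by simp, ?_, ?_⟩
  · by_cases hn : n = 0
    · subst hn
      simp [hg0]
    · simp [hn]
  · intro i hi
    rcases lt_trichotomy i m with h | h | h
    · simpa [h.le, Nat.succ_le_of_lt h] using hf i h
    · subst h
      simpa [hg0] using hg 0 (by omega)
    · have := hg (i - m) (by omega)
      rw [show i - m + 1 = i + 1 - m by omega] at this
      simpa [not_le.2 h, not_le.2 (h.trans (Nat.lt_succ_self i))] using this

theorem hasWalk_sub {G : Digraph V} {n : ℕ} {f : ℕ → V} (hf : ∀ i < n, G.Adj (f i) (f (i + 1)))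
    {i j : ℕ} (hij : i ≤ j) (hj : j ≤ n) : G.HasWalk (j - i) (f i) (f j) := by
  refine ⟨fun l => f (i + l), rfl, by simp [hij], fun l hl => ?_⟩
  simpa [add_assoc] using hf (i + l) (by omega)

/-- A repeated vertex splits a closed walk into two shorter ones; without repetition the walk is
itself a directed cycle. -/
theorem dvd_of_hasWalk_self {G : Digraph V} {k : ℕ} (hG : G.IsLCycleDigraph {k}) :
    ∀ (n : ℕ) (u : V), G.HasWalk n u u → k ∣ n := by
  intro n
  induction n using Nat.strong_induction_on with
  | _ n ih =>
    rintro u ⟨f, h0, hn, hf⟩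
    by_cases hn0 : n = 0
    · simp [hn0]
    have : NeZero n := ⟨hn0⟩
    by_cases hinj : ∃ i j, i < j ∧ j < n ∧ f i = f j
    · obtain ⟨i, j, hij, hj, he⟩ := hinj
      have h1 := hasWalk_sub hf hij.le hj.le
      have h2 := (hasWalk_sub hf (Nat.zero_le i) (hij.le.trans hj.le))
      have h3 := hasWalk_sub hf hj.le le_rfl
      rw [← he] at h1 h3
      have h4 := h2.trans h3
      rw [h0, hn] at h4
      have h5 := ih (j - i) (by omega) _ h1
      have h6 := ih _ (by omega) _ h4
      have := dvd_add h5 h6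
      rwa [show j - i + (i - 0 + (n - j)) = n by omega] at this
    · push Not at hinj
      have hd : G.IsDicycle (cycleOfFn fun i : ZMod n => f i.val) := by
        apply isDicycle_cycleOfFn
        · intro i j hij
          apply ZMod.val_injective n
          by_contra hne
          rcases lt_or_gt_of_ne hne with h | h
          · exact hinj _ _ h (ZMod.val_lt _) hij
          · exact hinj _ _ h (ZMod.val_lt _) hij.symm
        · intro i
          have hi := ZMod.val_lt i
          have := hf _ hi
          have hv : (i + 1).val = (i.val + 1) % n := by
            have h := ZMod.val_natCast n (i.val + 1)
            rw [← h]
            simp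
          rcases Nat.lt_or_ge (i.val + 1) n with h | h
          · rwa [hv, Nat.mod_eq_of_lt h]
          · have h : i.val + 1 = n := by omega
            rw [h, hn, ← h0] at this
            rwa [hv, h, Nat.mod_self]
      have := hG.2 _ hd
      rw [length_cycleOfFn, Set.mem_singleton_iff] at this
      simp [this]

/-- The digraph formed by the arcs lying on closed walks. -/
def cyclicPart (G : Digraph V) : Digraph V where
  Adj u v := G.Adj u v ∧ ∃ n, G.HasWalk n v u

/-- All arcs of `G` go from a class of `c` to the cyclically next one. -/
def IsGraded (G : Digraph V) {k : ℕ} (c : V → ZMod k) : Prop :=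
  ∀ u v, G.Adj u v → c v = c u + 1

/-- In each strong component fix a root `r` and colour `v` by the length mod `k` of some walk from
`r` to `v`. Closing two such walks by a common return walk to the root shows that the colour
increases by 1 along every arc inside the component. -/
theorem exists_isGraded_cyclicPart {G : Digraph V} {k : ℕ} (hG : G.IsLCycleDigraph {k}) :
    ∃ c : V → ZMod k, G.cyclicPart.IsGraded c := by
  classical
  let s : Setoid V :=
    { r := fun u v => (∃ n, G.HasWalk n u v) ∧ ∃ n, G.HasWalk n v u
      iseqv :=
        ⟨fun u => ⟨⟨0, .refl G u⟩, ⟨0, .refl G u⟩⟩, fun h => ⟨h.2, h.1⟩,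
          fun ⟨⟨_, a⟩, ⟨_, b⟩⟩ ⟨⟨_, c⟩, ⟨_, d⟩⟩ => ⟨⟨_, a.trans c⟩, ⟨_, d.trans b⟩⟩⟩ }
  let r : V → V := fun v => (Quotient.mk s v).out
  have hr : ∀ v, (∃ n, G.HasWalk n (r v) v) ∧ ∃ n, G.HasWalk n v (r v) := fun v =>
    Quotient.exact (Quotient.out_eq (Quotient.mk s v))
  choose d hd using fun v => (hr v).1
  refine ⟨fun v => (d v : ZMod k), ?_⟩
  rintro u v ⟨huv, n, hn⟩
  have hruv : r u = r v := by
    have : Quotient.mk s u = Quotient.mk s v := Quotient.sound ⟨⟨1, .of_adj huv⟩, ⟨n, hn⟩⟩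
    simp only [r, this]
  obtain ⟨e, he⟩ := (hr v).2
  have h1 := dvd_of_hasWalk_self hG _ _ ((hd v).trans he)
  have h2 := (((hd u).trans (.of_adj huv)).trans he)
  rw [hruv] at h2
  have h2 := dvd_of_hasWalk_self hG _ _ h2
  rw [← ZMod.natCast_eq_zero_iff] at h1 h2
  push_cast at h1 h2
  linear_combination h1 - h2

theorem hasWalk_of_zmod {G : Digraph V} {m : ℕ} [NeZero m] {f : ZMod m → V}
    (hf : ∀ i, G.Adj (f i) (f (i + 1))) (i j : ZMod m) : ∃ n, G.HasWalk n (f i) (f j) := by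
  refine ⟨(j - i).val, fun l => f (i + l), by simp, by simp, fun l _ => ?_⟩
  simpa [add_assoc] using hf (i + l)

theorem isDicycle_cyclicPart_iff {G : Digraph V} {C : Cycle V} :
    G.cyclicPart.IsDicycle C ↔ G.IsDicycle C := by
  refine ⟨IsDicycle.mono fun u v (h : G.cyclicPart.Adj u v) => h.1, fun h => ?_⟩
  obtain ⟨h0, f, hf, hadj, hC⟩ := h.exists_eq_cycleOfFn
  have : NeZero C.length := ⟨h0⟩
  rw [← hC]
  exact isDicycle_cycleOfFn _ hf fun i => ⟨hadj i, hasWalk_of_zmod hadj _ _⟩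

theorem numDicycles_cyclicPart (G : Digraph V) : G.cyclicPart.numDicycles = G.numDicycles := by
  simp only [numDicycles, isDicycle_cyclicPart_iff]

theorem IsLCycleDigraph.cyclicPart {G : Digraph V} {L : Set ℕ} (hG : G.IsLCycleDigraph L) :
    G.cyclicPart.IsLCycleDigraph L :=
  ⟨fun v h => hG.1 v h.1, fun C hC => hG.2 C (isDicycle_cyclicPart_iff.1 hC)⟩

/-- The closed transversals: choices of one vertex from each class which form a directed cycle. -/
def IsCyclicTransversal (G : Digraph V) {k : ℕ} (c : V → ZMod k) (x : ZMod k → V) : Prop :=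
  (∀ i, c (x i) = i) ∧ ∀ i, G.Adj (x i) (x (i + 1))

theorem IsCyclicTransversal.injective {G : Digraph V} {k : ℕ} {c : V → ZMod k} {x : ZMod k → V}
    (hx : G.IsCyclicTransversal c x) : Function.Injective x := fun i j h => by
  rw [← hx.1 i, ← hx.1 j, h]

/-- A directed cycle of length `k` winds once around the classes, and exactly one rotation of its
parametrization sends each index to a vertex of that colour. -/
theorem numDicycles_eq_ncard_isCyclicTransversal {G : Digraph V} {k : ℕ} [NeZero k]
    {c : V → ZMod k} (hc : G.IsGraded c) (hG : ∀ C, G.IsDicycle C → C.length = k) :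
    G.numDicycles = {x | G.IsCyclicTransversal c x}.ncard := by
  have himage : {C : Cycle V | G.IsDicycle C} = cycleOfFn '' {x | G.IsCyclicTransversal c x} := by
    ext C
    simp only [Set.mem_ofPred_eq, Set.mem_image]
    constructor
    · intro hC
      have hk := hG C hC
      obtain ⟨-, f, hf, hadj, h⟩ := hC.exists_eq_cycleOfFn
      revert f
      rw [hk]
      intro f hf hadj h
      refine ⟨fun i => f (i + -c (f 0)), ⟨?_, ?_⟩, ?_⟩
      · have key : ∀ n : ℕ, c (f (n : ZMod k)) = c (f 0) + n := by
          intro n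
          induction n with
          | zero => simp
          | succ n ih =>
            have := hc _ _ (hadj n)
            push_cast
            rw [this, ih, add_assoc]
        intro i
        have := key (i + -c (f 0)).val
        rw [ZMod.natCast_zmod_val] at this
        rw [this]
        ring
      · intro i
        have := hadj (i + -c (f 0))
        rwa [add_right_comm] at this
      · rw [cycleOfFn_add_right, h]
    · rintro ⟨x, hx, rfl⟩
      exact isDicycle_cycleOfFn _ hx.injective hx.2
  rw [numDicycles, himage, Set.InjOn.ncard_image]
  intro x hx y hy hxy
  funext i
  have h1 : x i ∈ cycleOfFn y := by
    have h := (mem_cycleOfFn x (x i)).2 ⟨i, rfl⟩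
    have hxy' : cycleOfFn x = cycleOfFn y := hxy
    rwa [hxy'] at h
  obtain ⟨j, hj⟩ := (mem_cycleOfFn y _).1 h1
  have : j = i := by rw [← hy.1 j, hj, hx.1 i]
  rw [← hj, this]

end Digraph

/-! ### Products of integers with a given sum. -/

/-- The largest product of `m` nonnegative integers with sum `M`, in closed form. -/
theorem prod_range_add_div {m M : ℕ} (hm : 0 < m) :
    ∏ i ∈ Finset.range m, (M + i) / m = (M / m) ^ (m - M % m) * (M / m + 1) ^ (M % m) := by
  have hr := Nat.mod_lt M hm
  have hM := Nat.div_add_mod M m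
  set q := M / m
  set r := M % m
  have h1 : ∀ i ∈ Finset.range (m - r), (M + i) / m = q := by
    intro i hi
    rw [Finset.mem_range] at hi
    rw [← hM, add_assoc, Nat.mul_add_div hm, Nat.div_eq_of_lt (by omega), add_zero]
  have h2 : ∀ i ∈ Finset.range r, (M + (m - r + i)) / m = q + 1 := by
    intro i hi
    rw [Finset.mem_range] at hi
    rw [← hM, show m * q + r + (m - r + i) = m * (q + 1) + i by rw [mul_add]; omega,
      Nat.mul_add_div hm, Nat.div_eq_of_lt (by omega), add_zero]
  conv_lhs => rw [show m = (m - r) + r by omega, Finset.prod_range_add]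
  rw [show m - r + r = m by omega, Finset.prod_congr rfl h1, Finset.prod_congr rfl h2]
  simp

theorem one_add_mul_inv_le_pow {q : ℕ} (hq : 0 < q) (j : ℕ) :
    (1 + j * (1 / q : ℚ)) ≤ ((q + 1 : ℚ) / q) ^ j := by
  have hq' : (0 : ℚ) < q := by exact_mod_cast hq
  have := one_add_mul_le_pow (a := (1 / q : ℚ)) (by have : (0:ℚ) ≤ 1 / q := by positivity
                                                    linarith) j
  rwa [show (1 : ℚ) + 1 / q = (q + 1) / q by field_simp] at this

/-- The convex function `((q + 1) / q) ^ (a - q)` agrees with the line `a / q` at `q` and `q + 1`,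
so it lies strictly above it at all other integers. Bernoulli's inequality supplies the estimate on
both sides. -/
theorem div_le_zpow {q : ℕ} (hq : 0 < q) (a : ℕ) :
    (a : ℚ) / q ≤ ((q + 1 : ℚ) / q) ^ ((a : ℤ) - q) ∧
      ((a : ℚ) / q = ((q + 1 : ℚ) / q) ^ ((a : ℤ) - q) ↔ a = q ∨ a = q + 1) := by
  have hq' : (0 : ℚ) < q := by exact_mod_cast hq
  rcases lt_or_ge a q with h | h
  · obtain ⟨i, rfl⟩ := Nat.exists_eq_add_of_lt h
    have key : ((a : ℚ)) / (a + i + 1 : ℕ) <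
        (((a + i + 1 : ℕ) + 1 : ℚ) / (a + i + 1 : ℕ)) ^ ((a : ℤ) - (a + i + 1 : ℕ)) := by
      rw [show ((a : ℤ) - (a + i + 1 : ℕ)) = -((i + 1 : ℕ) : ℤ) by push_cast; ring, zpow_neg,
        zpow_natCast, ← inv_pow, inv_div]
      set Q : ℚ := ((a + i + 1 : ℕ) : ℚ) with hQ
      have h1 := one_add_mul_le_pow (a := -(1 / (Q + 1))) (by
        have : 1 / (Q + 1) ≤ 1 := by
          rw [div_le_one (by positivity)]
          linarith
        linarith) (i + 1)
      rw [show 1 + -(1 / (Q + 1)) = Q / (Q + 1) by field_simp; ring] at h1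
      refine lt_of_lt_of_le ?_ h1
      have ha : (a : ℚ) = Q - (i + 1 : ℕ) := by rw [hQ]; push_cast; ring
      rw [ha]
      have h2 : (Q - (i + 1 : ℕ)) / Q = 1 - (i + 1 : ℕ) * (1 / Q) := by field_simp
      rw [h2]
      have h3 : 1 / (Q + 1) < 1 / Q := one_div_lt_one_div_of_lt hq' (by linarith)
      have h4 : (0 : ℚ) < (i + 1 : ℕ) := by positivity
      nlinarith
    exact ⟨key.le, ⟨fun h => absurd h key.ne, fun h => by omega⟩⟩
  · obtain ⟨j, rfl⟩ := Nat.exists_eq_add_of_le h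
    rw [show (((q + j : ℕ) : ℤ) - q) = (j : ℤ) by push_cast; ring, zpow_natCast]
    have h1 : (((q + j : ℕ) : ℚ)) / q = 1 + j * (1 / q) := by push_cast; field_simp
    rw [h1]
    refine ⟨one_add_mul_inv_le_pow hq j, ?_⟩
    match j with
    | 0 => simp
    | 1 =>
      refine ⟨fun _ => Or.inr rfl, fun _ => ?_⟩
      field_simp
      simp
    | j + 2 =>
      refine ⟨fun h => ?_, fun h => by omega⟩
      exfalso
      have h2 := one_add_mul_inv_le_pow hq (j + 1)
      have h3 : (1 : ℚ) + (j + 2 : ℕ) * (1 / q) < (1 + (j + 1 : ℕ) * (1 / q)) * ((q + 1) / q) := by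
        rw [show ((q : ℚ) + 1) / q = 1 + 1 / q by field_simp]
        push_cast
        have : (0 : ℚ) < 1 / q := by positivity
        have h5 : (0 : ℚ) ≤ j := by positivity
        nlinarith [mul_pos this this, mul_nonneg h5 (mul_pos this this).le]
      have h4 : (0 : ℚ) < (q + 1) / q := by positivity
      rw [pow_succ] at h
      nlinarith [mul_le_mul_of_nonneg_right h2 h4.le]

theorem ceilDiv_eq_ite {m : ℕ} (hm : 0 < m) (M : ℕ) :
    M ⌈/⌉ m = if M % m = 0 then M / m else M / m + 1 := by
  have hmod := Nat.div_add_mod M m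
  have hr := Nat.mod_lt M hm
  rw [Nat.ceilDiv_eq_add_pred_div]
  split_ifs with h0
  · conv_lhs => rw [← hmod, h0]
    rw [show m * (M / m) + 0 + m - 1 = m * (M / m) + (m - 1) by omega, Nat.mul_add_div hm,
      Nat.div_eq_of_lt (show m - 1 < m by omega), add_zero]
  · conv_lhs => rw [← hmod]
    rw [show m * (M / m) + M % m + m - 1 = m * (M / m + 1) + (M % m - 1) by
      rw [mul_add]; omega, Nat.mul_add_div hm,
      Nat.div_eq_of_lt (show M % m - 1 < m by omega), add_zero]

section

variable {ι : Type*} {s : Finset ι} {a : ι → ℕ} {m M : ℕ}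

/-- The exponents sum to `M % m`, so multiplying the bounds of `div_le_zpow` gives a value
independent of `a`. -/
theorem prod_div_zpow (hm : 0 < m) (hs : s.card = m) (hsum : ∑ i ∈ s, a i = M) (hM : m ≤ M) :
    ((M / m : ℕ) : ℚ) ^ m *
      ∏ i ∈ s, (((M / m : ℕ) + 1 : ℚ) / (M / m : ℕ)) ^ ((a i : ℤ) - (M / m : ℕ)) =
      ((∏ i ∈ Finset.range m, (M + i) / m : ℕ) : ℚ) := by
  have hq : 0 < M / m := Nat.div_pos hM hm
  have hmod := Nat.div_add_mod M m
  have hr := Nat.mod_lt M hm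
  rw [prod_range_add_div hm]
  set q := M / m
  set r := M % m
  have hq' : (0 : ℚ) < q := by exact_mod_cast hq
  have hp : ((q + 1 : ℚ) / q) ≠ 0 := by positivity
  have h1 : ∏ i ∈ s, ((q + 1 : ℚ) / q) ^ ((a i : ℤ) - q) =
      ((q + 1 : ℚ) / q) ^ (∑ i ∈ s, ((a i : ℤ) - q)) := by
    classical
    clear hs hsum
    induction s using Finset.induction_on with
    | empty => simp
    | insert i s hi ih => rw [Finset.prod_insert hi, Finset.sum_insert hi, zpow_add₀ hp, ih]
  have h2 : ∑ i ∈ s, ((a i : ℤ) - q) = (r : ℤ) := by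
    rw [Finset.sum_sub_distrib, Finset.sum_const, hs, ← Nat.cast_sum, hsum, ← hmod]
    simp
  rw [h1, h2, zpow_natCast, div_pow]
  push_cast
  rw [show (q : ℚ) ^ m = (q : ℚ) ^ (m - r) * (q : ℚ) ^ r by rw [← pow_add]; congr 1; omega]
  field_simp

theorem prod_le_prod_range_add_div (hm : 0 < m) (hs : s.card = m) (hsum : ∑ i ∈ s, a i = M)
    (hM : m ≤ M) : ∏ i ∈ s, a i ≤ ∏ i ∈ Finset.range m, (M + i) / m := by
  have hq : 0 < M / m := Nat.div_pos hM hm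
  have hq' : (0 : ℚ) < (M / m : ℕ) := by exact_mod_cast hq
  have h := prod_div_zpow hm hs hsum hM
  have h1 : ∏ i ∈ s, ((a i : ℚ) / (M / m : ℕ)) ≤ ∏ i ∈ s,
      (((M / m : ℕ) + 1 : ℚ) / (M / m : ℕ)) ^ ((a i : ℤ) - (M / m : ℕ)) :=
    Finset.prod_le_prod (fun i _ => by positivity) fun i _ => (div_le_zpow hq (a i)).1
  rw [Finset.prod_div_distrib, Finset.prod_const, hs, div_le_iff₀' (by positivity), h] at h1
  exact_mod_cast h1

theorem prod_eq_prod_range_add_div_iff (hm : 0 < m) (hs : s.card = m) (hsum : ∑ i ∈ s, a i = M)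
    (hM : m ≤ M) : ∏ i ∈ s, a i = ∏ i ∈ Finset.range m, (M + i) / m ↔
      ∀ i ∈ s, a i = M / m ∨ a i = M ⌈/⌉ m := by
  have hq : 0 < M / m := Nat.div_pos hM hm
  have hq' : (0 : ℚ) < (M / m : ℕ) := by exact_mod_cast hq
  have h := prod_div_zpow hm hs hsum hM
  have hmod := Nat.div_add_mod M m
  have hr := Nat.mod_lt M hm
  have hceil := ceilDiv_eq_ite hm M
  have h2 : (∏ i ∈ s, a i = ∏ i ∈ Finset.range m, (M + i) / m) ↔
      ∏ i ∈ s, ((a i : ℚ) / (M / m : ℕ)) = ∏ i ∈ s,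
        (((M / m : ℕ) + 1 : ℚ) / (M / m : ℕ)) ^ ((a i : ℤ) - (M / m : ℕ)) := by
    rw [Finset.prod_div_distrib, Finset.prod_const, hs, div_eq_iff (by positivity), mul_comm _ (_ ^ m),
      h]
    exact_mod_cast Iff.rfl
  have h3 : (∀ i ∈ s, a i = M / m ∨ a i = M ⌈/⌉ m) ↔ ∀ i ∈ s, a i = M / m ∨ a i = M / m + 1 := by
    rw [hceil]
    split_ifs with h0
    -- When `m` divides `M`, floor and ceiling coincide; values at least `M / m` with average `M /
    -- m` are all equal to it.
    · refine ⟨fun h i hi => Or.inl (by simpa using h i hi), fun h => ?_⟩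
      have hle : ∀ i ∈ s, M / m ≤ a i := fun i hi => by rcases h i hi with h | h <;> omega
      have hs' : ∑ i ∈ s, M / m = ∑ i ∈ s, a i := by
        rw [Finset.sum_const, hs, hsum, smul_eq_mul]
        omega
      have := (Finset.sum_eq_sum_iff_of_le hle).1 hs'
      exact fun i hi => Or.inl (this i hi).symm
    · rfl
  rw [h2, h3]
  constructor
  · intro he i hi
    by_contra hcon
    have hlt : ∀ i ∈ s, 0 < a i := by
      intro i hi
      by_contra h0
      have h0 : a i = 0 := by omega
      have hz : ∏ i ∈ s, ((a i : ℚ) / (M / m : ℕ)) = 0 := Finset.prod_eq_zero hi (by simp [h0])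
      rw [hz] at he
      have : (0 : ℚ) < ∏ i ∈ s,
        (((M / m : ℕ) + 1 : ℚ) / (M / m : ℕ)) ^ ((a i : ℤ) - (M / m : ℕ)) :=
        Finset.prod_pos fun i _ => by positivity
      rw [← he] at this
      exact lt_irrefl _ this
    refine (Finset.prod_lt_prod (fun i hi => ?_) (fun i _ => (div_le_zpow hq (a i)).1)
      ⟨i, hi, lt_of_le_of_ne (div_le_zpow hq (a i)).1 fun h => hcon ((div_le_zpow hq (a i)).2.1 h)⟩).ne he
    have : (0 : ℚ) < a i := by exact_mod_cast hlt i hi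
    positivity
  · intro h
    exact Finset.prod_congr rfl fun i hi => (div_le_zpow hq (a i)).2.2 (h i hi)

end

/-! ### Edge counts of forests, and shifts inside colour classes. -/

/-- The forest extends to a spanning tree of the complete graph and equals it when the edge counts
agree. -/
theorem SimpleGraph.IsAcyclic.ncard_edgeSet_add_one_le {V : Type*} [Finite V] [Nonempty V]
    {F : SimpleGraph V} (hF : F.IsAcyclic) :
    F.edgeSet.ncard + 1 ≤ Nat.card V ∧ (F.edgeSet.ncard + 1 = Nat.card V → F.IsTree) := by
  classical
  have := Fintype.ofFinite V
  obtain ⟨T, hFT, -, hT⟩ := SimpleGraph.Connected.exists_isTree_le_of_le_of_isAcyclic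
    (G := (⊤ : SimpleGraph V)) SimpleGraph.connected_top le_top hF
  have hcard := (SimpleGraph.isTree_iff_connected_and_card.1 hT).2
  rw [Nat.card_coe_set_eq] at hcard
  have hsub : F.edgeSet ⊆ T.edgeSet := SimpleGraph.edgeSet_mono hFT
  have hle := Set.ncard_le_ncard hsub (Set.toFinite _)
  refine ⟨by omega, fun h => ?_⟩
  have : F.edgeSet = T.edgeSet := Set.eq_of_subset_of_ncard_le hsub (by omega) (Set.toFinite _)
  rwa [SimpleGraph.edgeSet_inj.1 this]

/-- Translations of a cyclic group of order `|A|`, transported to `A`. -/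
theorem exists_perm_shifts {A : Type*} [Fintype A] :
    ∃ π : ℕ → Equiv.Perm A, π 0 = 1 ∧ ∀ v l l', l < Fintype.card A → l' < Fintype.card A →
      π l v = π l' v → l = l' := by
  rcases isEmpty_or_nonempty A with h | h
  · exact ⟨fun _ => 1, rfl, fun v => (h.false v).elim⟩
  · have : NeZero (Fintype.card A) := ⟨Fintype.card_ne_zero⟩
    have e : ZMod (Fintype.card A) ≃ A := Fintype.equivOfCardEq (by rw [ZMod.card])
    refine ⟨fun l => e.symm.trans ((Equiv.addRight (l : ZMod (Fintype.card A))).trans e), ?_, ?_⟩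
    · ext v
      simp
    · intro v l l' hl hl' h
      simp only [Equiv.trans_apply, Equiv.coe_addRight, EmbeddingLike.apply_eq_iff_eq,
        add_right_inj] at h
      rw [ZMod.natCast_eq_natCast_iff'] at h
      rwa [Nat.mod_eq_of_lt hl, Nat.mod_eq_of_lt hl'] at h

/-- Permutations preserving a coloring whose orbits sweep every color class. -/
theorem exists_fiberwise_perm_shifts {V ι : Type*} [Fintype V] [DecidableEq ι] (c : V → ι) :
    ∃ σ : ℕ → Equiv.Perm V, σ 0 = 1 ∧ (∀ l v, c (σ l v) = c v) ∧
      ∀ v l l', l < Fintype.card {u // c u = c v} → l' < Fintype.card {u // c u = c v} →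
        σ l v = σ l' v → l = l' := by
  choose π h0 hπ using fun i : ι => exists_perm_shifts (A := {u // c u = i})
  have happ : ∀ l v, (Equiv.sigmaFiberEquiv c).permCongr
      (Equiv.sigmaCongrRight fun i => π i l) v = (π (c v) l ⟨v, rfl⟩ : V) := fun l v => rfl
  refine ⟨fun l => (Equiv.sigmaFiberEquiv c).permCongr (Equiv.sigmaCongrRight fun i => π i l),
    ?_, ?_, ?_⟩
  · ext v
    rw [happ, h0]
    rfl
  · intro l v
    rw [happ]
    exact (π (c v) l ⟨v, rfl⟩).2
  · intro v l l' hl hl' h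
    rw [happ, happ] at h
    exact hπ _ _ _ _ hl hl' (Subtype.ext h)

/-! ### The forest of closing vertices. -/

namespace Digraph

variable {V : Type*}

/-- The vertices `x i` form a directed cycle in the cyclic order of their indices. -/
def IsCyclicTuple (G : Digraph V) {k : ℕ} (x : ZMod k → V) : Prop :=
  ∀ i, G.Adj (x i) (x (i + 1))

section incidence

variable {k : ℕ} {A B : Type*}

/-- The bipartite graph joining `a` to `b` if replacing the vertex of index `0` in `y b` by `u a`
gives a directed cycle. -/
def closingGraph (G : Digraph V) (u : A → V) (y : B → ZMod k → V) : SimpleGraph (A ⊕ B) :=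
  SimpleGraph.fromRel fun p q => ∃ a b, p = Sum.inl a ∧ q = Sum.inr b ∧
    G.IsCyclicTuple (Function.update (y b) 0 (u a))

theorem closingGraph_adj (G : Digraph V) (u : A → V) (y : B → ZMod k → V) {a : A} {b : B} :
    (G.closingGraph u y).Adj (Sum.inl a) (Sum.inr b) ↔
      G.IsCyclicTuple (Function.update (y b) 0 (u a)) := by
  simp [closingGraph]

theorem closingGraph_adj' (G : Digraph V) (u : A → V) (y : B → ZMod k → V) {a : A} {b : B} :
    (G.closingGraph u y).Adj (Sum.inr b) (Sum.inl a) ↔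
      G.IsCyclicTuple (Function.update (y b) 0 (u a)) := by
  rw [SimpleGraph.adj_comm, closingGraph_adj]

theorem not_closingGraph_adj_inl (G : Digraph V) (u : A → V) (y : B → ZMod k → V) {a a' : A} :
    ¬ (G.closingGraph u y).Adj (Sum.inl a) (Sum.inl a') := by
  simp [closingGraph]

theorem not_closingGraph_adj_inr (G : Digraph V) (u : A → V) (y : B → ZMod k → V) {b b' : B} :
    ¬ (G.closingGraph u y).Adj (Sum.inr b) (Sum.inr b') := by
  simp [closingGraph]

/-- The vertices with nonzero index of a cyclic tuple, as a directed path. -/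
def openPath (x : ZMod k → V) : List V :=
  (List.range (k - 1)).map fun i : ℕ => x ((i + 1 : ℕ) : ZMod k)

theorem length_openPath (x : ZMod k → V) : (openPath x).length = k - 1 := by
  simp [openPath]

theorem natCast_ne_zero_of_lt {i : ℕ} (hi : i + 1 < k) : ((i + 1 : ℕ) : ZMod k) ≠ 0 := by
  rw [Ne, ZMod.natCast_eq_zero_iff]
  exact Nat.not_dvd_of_pos_of_lt (Nat.succ_pos i) hi

theorem mem_openPath {x : ZMod k → V} {v : V} (h : v ∈ openPath x) : ∃ i, i ≠ 0 ∧ x i = v := by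
  simp only [openPath, List.mem_map, List.mem_range] at h
  obtain ⟨i, hi, rfl⟩ := h
  exact ⟨_, natCast_ne_zero_of_lt (by omega), rfl⟩

theorem head?_openPath (hk : 2 ≤ k) (x : ZMod k → V) : (openPath x).head? = some (x 1) := by
  obtain ⟨m, rfl⟩ := Nat.exists_eq_add_of_le' hk
  simp [openPath, List.range_succ_eq_map]

theorem getLast?_openPath (hk : 2 ≤ k) (x : ZMod k → V) :
    (openPath x).getLast? = some (x (-1)) := by
  obtain ⟨m, rfl⟩ := Nat.exists_eq_add_of_le' hk
  have : ((m + 1 : ℕ) : ZMod (m + 2)) = -1 := by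
    have := ZMod.natCast_self (m + 2)
    push_cast at this ⊢
    linear_combination this
  simp only [openPath, show m + 2 - 1 = m + 1 from rfl, List.range_succ,
    List.map_append, List.map_cons, List.map_nil, List.getLast?_append, List.getLast?_singleton,
    Option.some_or, this]

theorem nodup_openPath {x : ZMod k → V} (hx : ∀ i j, i ≠ 0 → j ≠ 0 → x i = x j → i = j) :
    (openPath x).Nodup := by
  refine List.Nodup.map_on ?_ List.nodup_range
  intro i hi j hj h
  rw [List.mem_range] at hi hj
  have := hx _ _ (natCast_ne_zero_of_lt (by omega)) (natCast_ne_zero_of_lt (by omega)) h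
  rw [ZMod.natCast_eq_natCast_iff', Nat.mod_eq_of_lt (by omega), Nat.mod_eq_of_lt (by omega)] at this
  omega

theorem isChain_openPath {G : Digraph V} {x : ZMod k → V}
    (hx : ∀ i, i ≠ 0 → i + 1 ≠ 0 → G.Adj (x i) (x (i + 1))) : (openPath x).IsChain G.Adj := by
  rw [openPath, List.isChain_iff_getElem]
  intro i hi
  simp only [List.length_map, List.length_range] at hi
  simp only [List.getElem_map, List.getElem_range]
  have h1 := natCast_ne_zero_of_lt (k := k) (i := i) (by omega)
  have h2 := natCast_ne_zero_of_lt (k := k) (i := i + 1) (by omega)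
  have := hx _ h1 (by push_cast at h2 ⊢; exact h2)
  push_cast at this ⊢
  exact this

theorem IsCyclicTuple.adj_of_update {G : Digraph V} {x : ZMod k → V} {w : V}
    (h : G.IsCyclicTuple (Function.update x 0 w)) {i : ZMod k} (hi : i ≠ 0) (hi' : i + 1 ≠ 0) :
    G.Adj (x i) (x (i + 1)) := by
  simpa [hi, hi'] using h i

theorem IsCyclicTuple.adj_first {G : Digraph V} (hk : 2 ≤ k) {x : ZMod k → V} {w : V}
    (h : G.IsCyclicTuple (Function.update x 0 w)) : G.Adj w (x 1) := by
  have : Fact (1 < k) := ⟨hk⟩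
  simpa using h 0

theorem IsCyclicTuple.adj_last {G : Digraph V} (hk : 2 ≤ k) {x : ZMod k → V} {w : V}
    (h : G.IsCyclicTuple (Function.update x 0 w)) : G.Adj (x (-1)) w := by
  have : Fact (1 < k) := ⟨hk⟩
  simpa using h (-1)

/-- A cycle of the graph alternates between vertices `u a` and paths `openPath (y b)`. Adjacency in
it provides arcs both into and out of the path, so the cycle can be traversed in either direction
and its blocks concatenate to a directed cycle of `G` that is too long. -/
theorem isAcyclic_closingGraph {G : Digraph V} (hk : 2 ≤ k)
    (hG : ∀ C, G.IsDicycle C → C.length = k) {u : A → V} {y : B → ZMod k → V}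
    (hu : Function.Injective u)
    (hy : ∀ b b' i i', i ≠ 0 → i' ≠ 0 → y b i = y b' i' → b = b' ∧ i = i')
    (huy : ∀ a b i, i ≠ 0 → y b i ≠ u a) : (G.closingGraph u y).IsAcyclic := by
  rw [SimpleGraph.isAcyclic_iff_free_cycleGraph]
  rintro n hn ⟨F⟩
  obtain ⟨m, rfl⟩ := Nat.exists_eq_add_of_le' hn
  set H := G.closingGraph u y
  obtain ⟨f, hf⟩ := F
  let g : ℕ → A ⊕ B := fun i => f ⟨i % (m + 3), Nat.mod_lt _ (by omega)⟩
  have hadj : ∀ i, H.Adj (g i) (g (i + 1)) := fun i => by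
    refine f.map_rel' ?_
    rw [SimpleGraph.cycleGraph_adj]
    refine Or.inr ?_
    rw [sub_eq_iff_eq_add]
    ext
    simp [Fin.val_add, add_comm]
  have hg0 : g (m + 3) = g 0 := by simp [g]
  have hg : ∀ i j, i < m + 3 → j < m + 3 → g i = g j → i = j := fun i j hi hj h => by
    have := congrArg Fin.val (hf h)
    simpa [Nat.mod_eq_of_lt hi, Nat.mod_eq_of_lt hj] using this
  let φ : A ⊕ B → List V := Sum.elim (fun a => [u a]) fun b => openPath (y b)
  let R : List V → List V → Prop := fun l₁ l₂ => ∀ x ∈ l₁.getLast?, ∀ z ∈ l₂.head?, G.Adj x z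
  have hR : ∀ p q, H.Adj p q → R (φ p) (φ q) := by
    rintro (a | b) (a' | b') h
    · exact absurd h (not_closingGraph_adj_inl G u y)
    · rw [closingGraph_adj] at h
      simpa [R, φ, head?_openPath hk] using h.adj_first hk
    · rw [closingGraph_adj'] at h
      simpa [R, φ, getLast?_openPath hk] using h.adj_last hk
    · exact absurd h (not_closingGraph_adj_inr G u y)
  let L : List (List V) := (List.range (m + 3)).map fun i : ℕ => φ (g i)
  have hdi : G.IsDicycle (L.flatten : List V) := by
    apply isDicycle_flatten
    · simp [L]
    · intro h
      simp only [L, List.mem_map] at h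
      obtain ⟨i, -, hi⟩ := h
      have hlen := congrArg List.length hi
      cases hfi : g i with
      | inl a => simp [φ, hfi] at hlen
      | inr b =>
        simp [φ, hfi, length_openPath] at hlen
        omega
    · rw [List.nodup_flatten]
      constructor
      · intro l hl
        simp only [L, List.mem_map] at hl
        obtain ⟨i, -, rfl⟩ := hl
        cases hfi : g i with
        | inl a => simp [φ]
        | inr b => exact nodup_openPath fun i j hi hj h => (hy _ _ _ _ hi hj h).2
      · rw [List.pairwise_map]
        refine List.Pairwise.imp_of_mem ?_ (List.nodup_range (n := m + 3))
        intro i j hi hj hij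
        rw [List.mem_range] at hi hj
        have hne : g i ≠ g j := fun h => hij (hg i j hi hj h)
        intro v hv hv'
        revert hv hv' hne
        generalize g i = p
        generalize g j = q
        rcases p with a | b <;> rcases q with a' | b' <;> intro hne hv hv'
        · simp only [φ, Sum.elim_inl, List.mem_singleton] at hv hv'
          exact hne (by rw [hu (hv.symm.trans hv')])
        · simp only [φ, Sum.elim_inl, List.mem_singleton] at hv
          obtain ⟨i, hi, h⟩ := mem_openPath (show v ∈ openPath _ from hv')
          exact huy _ _ _ hi (h.trans hv)
        · simp only [φ, Sum.elim_inl, List.mem_singleton] at hv'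
          obtain ⟨i, hi, h⟩ := mem_openPath (show v ∈ openPath _ from hv)
          exact huy _ _ _ hi (h.trans hv')
        · obtain ⟨i, hi, h⟩ := mem_openPath hv
          obtain ⟨i', hi', h'⟩ := mem_openPath hv'
          exact hne (by rw [(hy _ _ _ _ hi hi' (h.trans h'.symm)).1])
    · intro l hl
      simp only [L, List.mem_map] at hl
      obtain ⟨i, -, rfl⟩ := hl
      have h := hadj i
      revert h
      generalize g i = p
      generalize g (i + 1) = q
      intro h
      rcases p with a | b
      · simp [φ]
      · rcases q with a' | b'
        · rw [closingGraph_adj'] at h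
          exact isChain_openPath fun i hi hi' => h.adj_of_update hi hi'
        · exact absurd h (not_closingGraph_adj_inr G u y)
    · have : (L : Cycle (List V)) = (List.range (m + 2).succ : Cycle ℕ).map
          fun i : ℕ => φ (g i) := rfl
      rw [this, Cycle.chain_map, Cycle.chain_range_succ]
      refine ⟨?_, fun i _ => hR _ _ (hadj i)⟩
      have h := hR _ _ (hadj (m + 2))
      rwa [hg0] at h
  have hlen := hG _ hdi
  rw [Cycle.length_coe, List.length_flatten, List.map_map] at hlen
  -- Three consecutive blocks already have `k + 1` or `2 * k - 1` vertices, more than `k`.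
  have hsub : ((List.range 3).map (List.length ∘ fun i : ℕ => φ (g i))).sum ≤
      ((List.range (m + 3)).map (List.length ∘ fun i : ℕ => φ (g i))).sum :=
    ((List.range_sublist.2 (by omega)).map _).sum_le_sum fun _ _ => Nat.zero_le _
  rw [hlen] at hsub
  have h01 := hadj 0
  have h12 := hadj 1
  simp only [show List.range 3 = [0, 1, 2] from rfl, List.map_cons, List.map_nil,
    Function.comp_apply, List.sum_cons, List.sum_nil] at hsub
  revert h01 h12 hsub
  generalize g 0 = p
  generalize g (0 + 1) = q
  generalize g (1 + 1) = r
  intro h01 h12 hsub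
  rcases p with a | b <;> rcases q with a' | b' <;> rcases r with a'' | b''
  all_goals first
    | exact absurd h01 (not_closingGraph_adj_inl G u y)
    | exact absurd h01 (not_closingGraph_adj_inr G u y)
    | exact absurd h12 (not_closingGraph_adj_inl G u y)
    | exact absurd h12 (not_closingGraph_adj_inr G u y)
    | (simp [φ, length_openPath] at hsub; omega)

theorem ncard_closing_add_one_le [Finite A] [Finite B] [Nonempty A] {G : Digraph V} (hk : 2 ≤ k)
    (hG : ∀ C, G.IsDicycle C → C.length = k) {u : A → V} {y : B → ZMod k → V}
    (hu : Function.Injective u)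
    (hy : ∀ b b' i i', i ≠ 0 → i' ≠ 0 → y b i = y b' i' → b = b' ∧ i = i')
    (huy : ∀ a b i, i ≠ 0 → y b i ≠ u a) :
    {p : A × B | G.IsCyclicTuple (Function.update (y p.2) 0 (u p.1))}.ncard + 1 ≤
        Nat.card A + Nat.card B ∧
      ({p : A × B | G.IsCyclicTuple (Function.update (y p.2) 0 (u p.1))}.ncard + 1 =
        Nat.card A + Nat.card B →
          ∀ b, ∃ a, G.IsCyclicTuple (Function.update (y b) 0 (u a))) := by
  have hac := (isAcyclic_closingGraph hk hG hu hy huy).ncard_edgeSet_add_one_le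
  rw [Nat.card_sum] at hac
  have hle : {p : A × B | G.IsCyclicTuple (Function.update (y p.2) 0 (u p.1))}.ncard ≤
      (G.closingGraph u y).edgeSet.ncard := by
    refine Set.ncard_le_ncard_of_injOn (fun p => s(Sum.inl p.1, Sum.inr p.2)) ?_ ?_ (Set.toFinite _)
    · rintro ⟨a, b⟩ h
      exact (closingGraph_adj G u y).2 h
    · rintro ⟨a, b⟩ - ⟨a', b'⟩ - h
      simpa using h
  refine ⟨by omega, fun h b => ?_⟩
  -- Equality makes the forest a tree, and a tree on at least two vertices has no isolated vertex.
  have hT := hac.2 (by omega)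
  have : Nontrivial (A ⊕ B) :=
    ⟨⟨Sum.inl (Classical.arbitrary A), Sum.inr b, by simp⟩⟩
  obtain ⟨q, hq⟩ := hT.connected.preconnected.exists_adj_of_nontrivial (Sum.inr b)
  rcases q with a | b'
  · exact ⟨a, (closingGraph_adj' G u y).1 hq⟩
  · exact absurd hq (not_closingGraph_adj_inr G u y)

end incidence

end Digraph

/-! ### Averaging the forest bound over all transversals. -/

namespace Digraph

variable {V : Type*} [Fintype V] {k : ℕ}

open Classical in
/-- The `i`-th color class of `c`. -/
noncomputable def colorClass (c : V → ZMod k) (i : ZMod k) : Finset V :=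
  Finset.univ.filter fun v => c v = i

open Classical in
theorem mem_colorClass {c : V → ZMod k} {i : ZMod k} {v : V} : v ∈ colorClass c i ↔ c v = i := by
  simp [colorClass]

theorem card_fiber_eq (c : V → ZMod k) (i : ZMod k) [Fintype {v // c v = i}] :
    Fintype.card {v // c v = i} = (colorClass c i).card := by
  classical
  rw [Fintype.card_subtype, colorClass]

theorem ncard_colorClass (c : V → ZMod k) (i : ZMod k) :
    {v | c v = i}.ncard = (colorClass c i).card := by
  rw [← Set.ncard_coe_finset]
  congr 1
  ext v
  simp [mem_colorClass]

theorem exists_class_shifts (c : V → ZMod k) : ∃ σ : ℕ → Equiv.Perm V, σ 0 = 1 ∧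
    (∀ l v, c (σ l v) = c v) ∧ ∀ v l l', l < (colorClass c (c v)).card →
      l' < (colorClass c (c v)).card → σ l v = σ l' v → l = l' := by
  classical
  obtain ⟨σ, h0, hσ, h⟩ := exists_fiberwise_perm_shifts c
  refine ⟨σ, h0, hσ, fun v l l' hl hl' => h v l l' ?_ ?_⟩
  · rwa [card_fiber_eq]
  · rwa [card_fiber_eq]

variable [NeZero k]

theorem sum_card_colorClass (c : V → ZMod k) :
    ∑ i, (colorClass c i).card = Fintype.card V := by
  classical
  rw [← Finset.card_univ, Finset.card_eq_sum_card_fiberwise (f := c) (t := Finset.univ) (by simp)]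
  exact Finset.sum_congr rfl fun i _ => by rw [colorClass]

/-- The choices of one vertex from each color class. -/
noncomputable def transversals (c : V → ZMod k) : Finset (ZMod k → V) :=
  Fintype.piFinset fun i => colorClass c i

theorem mem_transversals {c : V → ZMod k} {x : ZMod k → V} :
    x ∈ transversals c ↔ ∀ i, c (x i) = i := by
  simp [transversals, mem_colorClass]

theorem card_transversals (c : V → ZMod k) :
    (transversals c).card = ∏ i, (colorClass c i).card :=
  Fintype.card_piFinset _

theorem update_mem_transversals {c : V → ZMod k} {x : ZMod k → V} (hx : x ∈ transversals c)
    {i : ZMod k} {w : V} (hw : c w = i) : Function.update x i w ∈ transversals c := by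
  rw [mem_transversals] at hx ⊢
  intro j
  by_cases h : j = i
  · subst h
    simpa using hw
  · simpa [h] using hx j

theorem perm_comp_mem_transversals {c : V → ZMod k} {x : ZMod k → V} (hx : x ∈ transversals c)
    {σ : Equiv.Perm V} (hσ : ∀ v, c (σ v) = c v) : σ ∘ x ∈ transversals c := by
  rw [mem_transversals] at hx ⊢
  intro j
  simp [hσ, hx j]

open Classical in
theorem ncard_isCyclicTransversal (G : Digraph V) (c : V → ZMod k) :
    {x | G.IsCyclicTransversal c x}.ncard = ((transversals c).filter G.IsCyclicTuple).card := by
  rw [← Set.ncard_coe_finset]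
  congr 1
  ext x
  simp [mem_transversals, IsCyclicTransversal, IsCyclicTuple]

-- Double counting. Each shift permutes the transversals, so all `t` shifts contribute equally, and
-- one shift contributes the pairs of a vertex `w` and a transversal that `w` closes.
open Classical in
theorem sum_card_closings (G : Digraph V) (c : V → ZMod k) (t : ℕ) {σ : ℕ → Equiv.Perm V}
    (hσ : ∀ l v, c (σ l v) = c v) :
    ∑ x ∈ transversals c, ((colorClass c 0 ×ˢ Finset.range t).filter fun p =>
        G.IsCyclicTuple (Function.update (σ p.2 ∘ x) 0 p.1)).card =
      t * ((colorClass c 0).card * ((transversals c).filter G.IsCyclicTuple).card) := by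
  simp only [Finset.card_filter]
  rw [Finset.sum_comm]
  have h1 : ∀ p : V × ℕ,
      ∑ x ∈ transversals c, (if G.IsCyclicTuple (Function.update (σ p.2 ∘ x) 0 p.1) then 1 else 0) =
        ∑ x ∈ transversals c, (if G.IsCyclicTuple (Function.update x 0 p.1) then 1 else 0) := by
    intro p
    refine Finset.sum_nbij' (fun x => σ p.2 ∘ x) (fun x => (σ p.2).symm ∘ x)
      (fun x hx => perm_comp_mem_transversals hx (hσ _))
      (fun x hx => perm_comp_mem_transversals hx fun v => ?_) (fun x _ => ?_) (fun x _ => ?_)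
      fun x _ => rfl
    · rw [← hσ p.2, Equiv.apply_symm_apply]
    · ext i
      simp
    · ext i
      simp
  simp only [h1]
  rw [Finset.sum_product_right]
  refine Eq.trans (b := ∑ _l ∈ Finset.range t, ∑ w ∈ colorClass c 0, ∑ x ∈ transversals c,
    if G.IsCyclicTuple (Function.update x 0 w) then 1 else 0) rfl ?_
  rw [Finset.sum_const, Finset.card_range, smul_eq_mul]
  congr 1
  rw [← smul_eq_mul, ← Finset.sum_const, ← Finset.sum_product', ← Finset.sum_product']
  have hmem : ∀ p ∈ colorClass c 0 ×ˢ transversals c,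
      (p.2 0, Function.update p.2 0 p.1) ∈ colorClass c 0 ×ˢ transversals c := by
    rintro ⟨w, x⟩ h
    rw [Finset.mem_product, mem_colorClass] at h ⊢
    exact ⟨mem_transversals.1 h.2 0, update_mem_transversals h.2 h.1⟩
  -- Exchanging `w` with the vertex of index 0 is an involution; it turns these pairs into pairs of
  -- an arbitrary class 0 vertex and a cyclic transversal.
  refine Finset.sum_nbij' (fun p => (p.2 0, Function.update p.2 0 p.1))
    (fun p => (p.2 0, Function.update p.2 0 p.1)) hmem hmem ?_ ?_ fun p _ => rfl
  · rintro ⟨w, x⟩ -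
    simp
  · rintro ⟨w, x⟩ -
    simp

/-- The representatives of the nonzero color classes of the first `t` shifts of `x` are distinct. -/
theorem shift_injective {c : V → ZMod k} {t : ℕ} (ht : ∀ i, i ≠ 0 → t ≤ (colorClass c i).card)
    {σ : ℕ → Equiv.Perm V} (hσ : ∀ l v, c (σ l v) = c v)
    (hinj : ∀ v l l', l < (colorClass c (c v)).card → l' < (colorClass c (c v)).card →
      σ l v = σ l' v → l = l') {x : ZMod k → V} (hx : x ∈ transversals c) {l l' : ℕ} (hl : l < t)
    (hl' : l' < t) {i i' : ZMod k} (hi : i ≠ 0) (h : σ l (x i) = σ l' (x i')) :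
    l = l' ∧ i = i' := by
  rw [mem_transversals] at hx
  have hii : i = i' := by
    have := congrArg c h
    rwa [hσ, hσ, hx, hx] at this
  subst hii
  have := ht i hi
  refine ⟨hinj (x i) l l' ?_ ?_ h, rfl⟩ <;> rw [hx] <;> omega

open Classical in
theorem card_closings_add_one_le {G : Digraph V} (hk : 2 ≤ k)
    (hG : ∀ C, G.IsDicycle C → C.length = k) {c : V → ZMod k} {t : ℕ}
    (h0 : (colorClass c 0).Nonempty) (ht : ∀ i, i ≠ 0 → t ≤ (colorClass c i).card)
    {σ : ℕ → Equiv.Perm V} (hσ : ∀ l v, c (σ l v) = c v)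
    (hinj : ∀ v l l', l < (colorClass c (c v)).card → l' < (colorClass c (c v)).card →
      σ l v = σ l' v → l = l') {x : ZMod k → V} (hx : x ∈ transversals c) :
    ((colorClass c 0 ×ˢ Finset.range t).filter fun p =>
        G.IsCyclicTuple (Function.update (σ p.2 ∘ x) 0 p.1)).card + 1 ≤
          (colorClass c 0).card + t ∧
    (((colorClass c 0 ×ˢ Finset.range t).filter fun p =>
        G.IsCyclicTuple (Function.update (σ p.2 ∘ x) 0 p.1)).card + 1 =
          (colorClass c 0).card + t →
      ∀ l < t, ∃ w ∈ colorClass c 0, G.IsCyclicTuple (Function.update (σ l ∘ x) 0 w)) := by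
  have hne : Nonempty {v // c v = 0} := by
    obtain ⟨v, hv⟩ := h0
    exact ⟨⟨v, mem_colorClass.1 hv⟩⟩
  have key := ncard_closing_add_one_le (A := {v // c v = 0}) (B := Fin t) hk hG
    (u := Subtype.val) (y := fun l => σ l ∘ x) Subtype.val_injective
    (by
      intro b b' i i' hi _ h
      obtain ⟨h1, h2⟩ := shift_injective ht hσ hinj hx b.2 b'.2 hi h
      exact ⟨Fin.ext h1, h2⟩)
    (by
      rintro ⟨a, ha⟩ b i hi h
      have := congrArg c h
      simp only [Function.comp_apply, hσ, mem_transversals.1 hx i, ha] at this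
      exact hi this)
  rw [Nat.card_eq_fintype_card, Nat.card_eq_fintype_card, Fintype.card_fin, card_fiber_eq] at key
  have hcard : {p : {v // c v = 0} × Fin t |
        G.IsCyclicTuple (Function.update (σ p.2 ∘ x) 0 (p.1 : V))}.ncard =
      ((colorClass c 0 ×ˢ Finset.range t).filter fun p =>
        G.IsCyclicTuple (Function.update (σ p.2 ∘ x) 0 p.1)).card := by
    rw [← Set.ncard_coe_finset]
    refine Set.ncard_congr (fun p _ => (p.1.1, p.2.1)) ?_ ?_ ?_
    · rintro ⟨⟨a, ha⟩, l⟩ h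
      simp only [Finset.coe_filter, Finset.mem_product, mem_colorClass, Finset.mem_range]
      exact ⟨⟨ha, l.2⟩, h⟩
    · rintro ⟨⟨a, ha⟩, l⟩ ⟨⟨a', ha'⟩, l'⟩ _ _ h
      simp only [Prod.mk.injEq] at h
      simp only [Prod.mk.injEq, Subtype.mk.injEq]
      exact ⟨h.1, Fin.ext h.2⟩
    · rintro ⟨a, l⟩ h
      simp only [Finset.coe_filter, Finset.mem_product, mem_colorClass, Finset.mem_range] at h
      exact ⟨(⟨a, h.1.1⟩, ⟨l, h.1.2⟩), h.2, rfl⟩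
  rw [hcard] at key
  refine ⟨key.1, fun h l hl => ?_⟩
  obtain ⟨⟨a, ha⟩, h⟩ := key.2 h ⟨l, hl⟩
  exact ⟨a, mem_colorClass.2 ha, h⟩

end Digraph

/-! ### The bound on cyclic transversals and its equality case. -/

namespace Digraph

variable {V : Type*}

/-- Two transversals which are disjoint apart from index `0` and closed up crosswise by two
different vertices of class `0` give a directed cycle of length `2 * k`. -/
theorem false_of_crossing {k : ℕ} [NeZero k] {G : Digraph V} (hk : 2 ≤ k)
    (hG : ∀ C, G.IsDicycle C → C.length = k) {c : V → ZMod k} {z z' : ZMod k → V}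
    (hz : ∀ i, c (z i) = i) (hz' : ∀ i, c (z' i) = i) (hne : ∀ i, i ≠ 0 → z i ≠ z' i) {w w' : V}
    (hw : c w = 0) (hw' : c w' = 0) (hww : w ≠ w')
    (hza : ∀ i, i ≠ 0 → i + 1 ≠ 0 → G.Adj (z i) (z (i + 1)))
    (hza' : ∀ i, i ≠ 0 → i + 1 ≠ 0 → G.Adj (z' i) (z' (i + 1)))
    (h1 : G.Adj w (z 1)) (h2 : G.Adj (z (-1)) w') (h3 : G.Adj w' (z' 1))
    (h4 : G.Adj (z' (-1)) w) : False := by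
  have hlen : ∀ x : ZMod k → V, openPath x ≠ [] := fun x h => by
    have := congrArg List.length h
    rw [length_openPath, List.length_nil] at this
    omega
  have hmem : ∀ {x : ZMod k → V}, (∀ i, c (x i) = i) → ∀ v ∈ openPath x, c v ≠ 0 := by
    intro x hx v hv
    obtain ⟨i, hi, rfl⟩ := mem_openPath hv
    rwa [hx]
  have hnd : ∀ {x : ZMod k → V}, (∀ i, c (x i) = i) → (openPath x).Nodup := fun hx =>
    nodup_openPath fun i j _ _ h => by rw [← hx i, h, hx]
  have hdisj : ∀ v ∈ openPath z, v ∉ openPath z' := by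
    intro v hv hv'
    obtain ⟨i, hi, rfl⟩ := mem_openPath hv
    obtain ⟨j, hj, h⟩ := mem_openPath hv'
    have : j = i := by rw [← hz' j, h, hz]
    subst this
    exact hne _ hi h.symm
  have hd := isDicycle_flatten G (L := [[w], openPath z, [w'], openPath z']) (by simp)
    (by
      have a := hlen z
      have b := hlen z'
      simp [a.symm, b.symm])
    (by
      rw [List.nodup_flatten]
      constructor
      · simp [hnd hz, hnd hz']
      · have e1 : w ∉ openPath z := fun h => hmem hz _ h hw
        have e2 : w ∉ openPath z' := fun h => hmem hz' _ h hw
        have e3 : w' ∉ openPath z := fun h => hmem hz _ h hw'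
        have e4 : w' ∉ openPath z' := fun h => hmem hz' _ h hw'
        simp only [List.pairwise_cons, List.mem_cons, List.not_mem_nil, or_false, forall_eq_or_imp,
          forall_eq, List.singleton_disjoint, List.disjoint_singleton, List.Pairwise.nil]
        exact ⟨⟨e1, hww, e2⟩, ⟨e3, hdisj⟩, e4, by simp⟩)
    (by
      simp only [List.mem_cons, List.not_mem_nil, or_false, forall_eq_or_imp, forall_eq]
      exact ⟨by simp, isChain_openPath hza, by simp, isChain_openPath hza'⟩)
    (by simp [head?_openPath hk, getLast?_openPath hk, h1, h2, h3, h4])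
  have := hG _ hd
  simp only [Cycle.length_coe, List.length_flatten, List.map_cons, List.map_nil, List.sum_cons,
    List.sum_nil, List.length_cons, List.length_nil, length_openPath] at this
  omega

variable [Fintype V] {k : ℕ} [NeZero k]

-- Equality in all forests means that every transversal can be closed by a vertex of class 0, so all
-- arcs between consecutive nonzero classes are present. Two disjoint transversals with different
-- closing vertices can then be crossed into one long cycle.
open Classical in
theorem false_of_card_closings_eq {G : Digraph V} (hk : 3 ≤ k)
    (hG : ∀ C, G.IsDicycle C → C.length = k) {c : V → ZMod k} {t : ℕ}
    (h0 : 2 ≤ (colorClass c 0).card) (ht2 : 2 ≤ t)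
    (ht : ∀ i, i ≠ 0 → t ≤ (colorClass c i).card)
    {σ : ℕ → Equiv.Perm V} (hσ0 : σ 0 = 1) (hσ : ∀ l v, c (σ l v) = c v)
    (hinj : ∀ v l l', l < (colorClass c (c v)).card → l' < (colorClass c (c v)).card →
      σ l v = σ l' v → l = l') (hne : (transversals c).Nonempty)
    (heq : ∀ x ∈ transversals c, ((colorClass c 0 ×ˢ Finset.range t).filter fun p =>
        G.IsCyclicTuple (Function.update (σ p.2 ∘ x) 0 p.1)).card + 1 =
          (colorClass c 0).card + t) : False := by
  have hk2 : 2 ≤ k := by omega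
  have hex : ∀ x ∈ transversals c, ∃ w, c w = 0 ∧ G.IsCyclicTuple (Function.update x 0 w) := by
    intro x hx
    obtain ⟨w, hw, h⟩ := (card_closings_add_one_le hk2 hG (Finset.card_pos.1 (by omega)) ht hσ
      hinj hx).2 (heq x hx) 0 (by omega)
    rw [hσ0] at h
    exact ⟨w, mem_colorClass.1 hw, h⟩
  obtain ⟨x, hx⟩ := hne
  -- There are `|V_0| + t - 1 > t` edges on `t` shifts, so one shift is closed by two vertices; one
  -- of them will differ from the vertex closing the disjoint transversal `y'`.
  obtain ⟨⟨w, l⟩, hp, ⟨w', l'⟩, hp', hpne, hll⟩ := Finset.exists_ne_map_eq_of_card_lt_of_maps_to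
    (s := (colorClass c 0 ×ˢ Finset.range t).filter fun p =>
        G.IsCyclicTuple (Function.update (σ p.2 ∘ x) 0 p.1)) (t := Finset.range t) (f := Prod.snd)
    (by
      rw [Finset.card_range]
      have := heq x hx
      omega)
    (by
      rintro ⟨w, l⟩ h
      simp only [Finset.coe_filter, Finset.mem_product] at h
      exact h.1.2)
  simp only at hll
  subst hll
  simp only [Finset.mem_filter, Finset.mem_product, mem_colorClass] at hp hp'
  have hww : w ≠ w' := fun h => hpne (by rw [h])
  set y := σ l ∘ x with hy_def
  have hy : y ∈ transversals c := perm_comp_mem_transversals hx (hσ l)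
  set y' := σ 1 ∘ y with hy'_def
  have hy' : y' ∈ transversals c := perm_comp_mem_transversals hy (hσ 1)
  have hyy : ∀ i, i ≠ 0 → y i ≠ y' i := by
    intro i hi h
    have := (shift_injective ht hσ hinj hy (l := 0) (l' := 1) (by omega) (by omega) hi
      (by rw [hσ0]; exact h)).1
    omega
  obtain ⟨v, hv, hcv⟩ := hex y' hy'
  obtain ⟨u, hu, hcu, huv⟩ : ∃ u, c u = 0 ∧ G.IsCyclicTuple (Function.update y 0 u) ∧ v ≠ u := by
    by_cases h : v = w
    · exact ⟨w', hp'.1.1, hp'.2, by rw [h]; exact hww⟩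
    · exact ⟨w, hp.1.1, hp.2, h⟩
  have h10 : (1 : ZMod k) ≠ 0 := by
    have : Fact (1 < k) := ⟨hk2⟩
    exact one_ne_zero
  -- This needs `k ≥ 3`: exchanging the vertices of index 1 must leave those of index -1 in place,
  -- so that the two transversals are really crossed.
  have h11 : (-1 : ZMod k) ≠ 1 := by
    intro h
    have h2 : ((2 : ℕ) : ZMod k) = 0 := by
      push_cast
      linear_combination -h
    rw [ZMod.natCast_eq_zero_iff] at h2
    exact absurd (Nat.le_of_dvd (by omega) h2) (by omega)
  have hz : Function.update y 1 (y' 1) ∈ transversals c :=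
    update_mem_transversals hy (mem_transversals.1 hy' 1)
  have hz' : Function.update y' 1 (y 1) ∈ transversals c :=
    update_mem_transversals hy' (mem_transversals.1 hy 1)
  obtain ⟨a, -, ha⟩ := hex _ hz
  obtain ⟨b, -, hb⟩ := hex _ hz'
  refine false_of_crossing hk2 hG (mem_transversals.1 hz) (mem_transversals.1 hz') ?_ hv hu huv
    (fun i hi hi' => ha.adj_of_update hi hi') (fun i hi hi' => hb.adj_of_update hi hi') ?_ ?_ ?_ ?_
  · intro i hi
    by_cases h : i = 1
    · subst h
      simpa using (hyy 1 hi).symm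
    · simpa [h] using hyy i hi
  · simpa using hcv.adj_first hk2
  · simpa [h11] using hcu.adj_last hk2
  · simpa using hcu.adj_first hk2
  · simpa [h11] using hcv.adj_last hk2

open Classical in
theorem card_cyclicTuple_le {G : Digraph V} (hk : 2 ≤ k)
    (hG : ∀ C, G.IsDicycle C → C.length = k) (c : V → ZMod k) (hn : k ≤ Fintype.card V) :
    ((transversals c).filter G.IsCyclicTuple).card ≤
        ∏ i ∈ Finset.range (k - 1), (Fintype.card V - 1 + i) / (k - 1) ∧
      (3 ≤ k → ((transversals c).filter G.IsCyclicTuple).card =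
        ∏ i ∈ Finset.range (k - 1), (Fintype.card V - 1 + i) / (k - 1) →
          ∃ i, (colorClass c i).card = 1) := by
  set N := ((transversals c).filter G.IsCyclicTuple).card with hN
  have hfpos : 0 < ∏ i ∈ Finset.range (k - 1), (Fintype.card V - 1 + i) / (k - 1) :=
    Finset.prod_pos fun i _ => Nat.div_pos (by omega) (by omega)
  -- An empty class leaves no transversal, while the bound is positive because `k ≤ n`.
  by_cases hempty : ∃ i, (colorClass c i).card = 0
  · obtain ⟨i, hi⟩ := hempty
    have hT : transversals c = ∅ := by
      rw [← Finset.card_eq_zero, card_transversals]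
      exact Finset.prod_eq_zero (Finset.mem_univ i) hi
    have hN0 : N = 0 :=
      Nat.eq_zero_of_le_zero ((Finset.card_filter_le _ _).trans_eq (Finset.card_eq_zero.2 hT))
    rw [hN0]
    exact ⟨Nat.zero_le _, fun _ h => by omega⟩
  push Not at hempty
  have h10 : (1 : ZMod k) ≠ 0 := by
    have : Fact (1 < k) := ⟨hk⟩
    exact one_ne_zero
  obtain ⟨j, hj, hmin⟩ := Finset.exists_min_image (Finset.univ.erase (0 : ZMod k))
    (fun i => (colorClass c i).card) ⟨1, Finset.mem_erase.2 ⟨h10, Finset.mem_univ _⟩⟩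
  have ht : ∀ i, i ≠ 0 → (colorClass c j).card ≤ (colorClass c i).card := fun i hi =>
    hmin i (Finset.mem_erase.2 ⟨hi, Finset.mem_univ _⟩)
  obtain ⟨σ, hσ0, hσ, hinj⟩ := exists_class_shifts c
  have hsum := sum_card_closings G c (colorClass c j).card hσ
  rw [← hN] at hsum
  have hpos0 : 0 < (colorClass c 0).card := Nat.pos_of_ne_zero (hempty 0)
  have hposj : 0 < (colorClass c j).card := Nat.pos_of_ne_zero (hempty j)
  have hle := fun x hx => (card_closings_add_one_le hk hG (Finset.card_pos.1 hpos0) ht hσ hinj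
    (x := x) hx).1
  have hsum1 : ∑ x ∈ transversals c, (((colorClass c 0 ×ˢ
      Finset.range (colorClass c j).card).filter fun p =>
        G.IsCyclicTuple (Function.update (σ p.2 ∘ x) 0 p.1)).card + 1) =
      (colorClass c j).card * ((colorClass c 0).card * N) + (transversals c).card := by
    rw [Finset.sum_add_distrib, hsum]
    simp
  have hsum2 : ∑ x ∈ transversals c, ((colorClass c 0).card + (colorClass c j).card) =
      (transversals c).card * ((colorClass c 0).card + (colorClass c j).card) := by simp
  have hmain := Finset.sum_le_sum hle
  rw [hsum1, hsum2] at hmain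
  set s := Finset.univ.erase (0 : ZMod k) with hs
  -- Class 0 and the smallest other class `j` are merged into one factor `p + q - 1`, leaving `k -
  -- 1` factors with sum `n - 1`.
  set b : ZMod k → ℕ := fun i =>
    if i = j then (colorClass c 0).card + (colorClass c j).card - 1 else (colorClass c i).card
    with hb
  have hbs : ∀ i ∈ s.erase j, b i = (colorClass c i).card := fun i hi => by
    simp [hb, Finset.ne_of_mem_erase hi]
  have hbj : b j = (colorClass c 0).card + (colorClass c j).card - 1 := by simp [hb]
  have hcards : s.card = k - 1 := by
    rw [hs, Finset.card_erase_of_mem (Finset.mem_univ _), Finset.card_univ, ZMod.card]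
  have hsumb : ∑ i ∈ s, b i = Fintype.card V - 1 := by
    rw [← sum_card_colorClass c, ← Finset.add_sum_erase _ _ (Finset.mem_univ (0 : ZMod k)), ← hs,
      ← Finset.add_sum_erase _ _ hj, ← Finset.add_sum_erase _ _ hj, Finset.sum_congr rfl hbs, hbj]
    omega
  have hprod : ∏ i ∈ s, b i ≤ _ := prod_le_prod_range_add_div (by omega) hcards hsumb (by omega)
  set Q := ∏ i ∈ s.erase j, (colorClass c i).card with hQ
  have hQpos : 0 < Q := Finset.prod_pos fun i _ => Nat.pos_of_ne_zero (hempty i)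
  have hprodb : ∏ i ∈ s, b i = ((colorClass c 0).card + (colorClass c j).card - 1) * Q := by
    rw [← Finset.mul_prod_erase _ _ hj, Finset.prod_congr rfl hbs, hbj]
  have hT : (transversals c).card = (colorClass c 0).card * ((colorClass c j).card * Q) := by
    rw [card_transversals, ← Finset.mul_prod_erase _ _ (Finset.mem_univ (0 : ZMod k)), ← hs,
      ← Finset.mul_prod_erase _ _ hj]
  rw [hprodb] at hprod
  set p := (colorClass c 0).card
  set q := (colorClass c j).card
  obtain ⟨r, hr⟩ : ∃ r, p + q = r + 1 := ⟨p + q - 1, by omega⟩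
  have hr' : p + q - 1 = r := by omega
  rw [hr'] at hprod
  have hmain' : N ≤ r * Q := by
    rw [hT, hr] at hmain
    have : p * q * N ≤ p * q * (r * Q) := by nlinarith
    exact Nat.le_of_mul_le_mul_left this (Nat.mul_pos hpos0 hposj)
  refine ⟨hmain'.trans hprod, fun hk3 hNeq => ?_⟩
  by_contra hcon
  push Not at hcon
  have hp2 : 2 ≤ p := by have := hcon 0; omega
  have hq2 : 2 ≤ q := by have := hcon j; omega
  have hNr : N = r * Q := le_antisymm hmain' (by rw [hNeq]; exact hprod)
  refine false_of_card_closings_eq hk3 hG hp2 hq2 ht hσ0 hσ hinj ?_ ?_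
  · rw [← Finset.card_pos, hT]
    exact Nat.mul_pos hpos0 (Nat.mul_pos hposj hQpos)
  -- Equality of the sums forces equality in the forest bound for each transversal.
  · refine (Finset.sum_eq_sum_iff_of_le hle).1 ?_
    rw [hsum1, hsum2, hT, hr, hNr]
    ring

end Digraph

/-! ### Extremal digraphs and balanced blow-ups. -/

namespace Digraph

variable {V : Type*} [Fintype V] {k : ℕ}

open Classical in
theorem IsGraded.numDicycles_eq_card [NeZero k] {G : Digraph V} {c : V → ZMod k}
    (hc : G.IsGraded c) (hG : ∀ C, G.IsDicycle C → C.length = k) :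
    G.numDicycles = ((transversals c).filter G.IsCyclicTuple).card := by
  rw [numDicycles_eq_ncard_isCyclicTransversal hc hG, ncard_isCyclicTransversal]

theorem numDicycles_le {G : Digraph V} (hk : 2 ≤ k) (hn : k ≤ Fintype.card V)
    (hG : G.IsLCycleDigraph {k}) :
    G.numDicycles ≤ ∏ i ∈ Finset.range (k - 1), (Fintype.card V - 1 + i) / (k - 1) := by
  have : NeZero k := ⟨by omega⟩
  obtain ⟨c, hc⟩ := exists_isGraded_cyclicPart hG
  rw [← numDicycles_cyclicPart, hc.numDicycles_eq_card hG.cyclicPart.2]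
  exact (card_cyclicTuple_le hk hG.cyclicPart.2 c hn).1

theorem prod_card_colorClass [NeZero k] {c : V → ZMod k} (h : (colorClass c 0).card = 1) :
    (transversals c).card = ∏ i ∈ Finset.univ.erase (0 : ZMod k), (colorClass c i).card ∧
      ∑ i ∈ Finset.univ.erase (0 : ZMod k), (colorClass c i).card = Fintype.card V - 1 ∧
      (Finset.univ.erase (0 : ZMod k)).card = k - 1 := by
  refine ⟨?_, ?_, ?_⟩
  · rw [card_transversals, ← Finset.mul_prod_erase _ _ (Finset.mem_univ (0 : ZMod k)), h, one_mul]
  · rw [← sum_card_colorClass c, ← Finset.add_sum_erase _ _ (Finset.mem_univ (0 : ZMod k)), h]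
    omega
  · rw [Finset.card_erase_of_mem (Finset.mem_univ _), Finset.card_univ, ZMod.card]

theorem isBalancedBlowup_of_numDicycles_eq {G : Digraph V} (hk : 3 ≤ k) (hn : k ≤ Fintype.card V)
    (hG : G.IsLCycleDigraph {k})
    (hN : G.numDicycles = ∏ i ∈ Finset.range (k - 1), (Fintype.card V - 1 + i) / (k - 1)) :
    G.IsBalancedBlowup k := by
  classical
  have : NeZero k := ⟨by omega⟩
  have : Fact (1 < k) := ⟨by omega⟩
  obtain ⟨c₀, hc₀⟩ := exists_isGraded_cyclicPart hG
  have hG' := hG.cyclicPart.2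
  rw [← numDicycles_cyclicPart] at hN
  obtain ⟨i₀, hi₀⟩ := (card_cyclicTuple_le (by omega) hG' c₀ hn).2 hk
    (by rw [← hN, hc₀.numDicycles_eq_card hG'])
  -- Rotating the colours moves the singleton class to 0.
  set c : V → ZMod k := fun v => c₀ v - i₀ with hc_def
  have hc : G.cyclicPart.IsGraded c := fun u v h => by
    rw [hc_def]
    simp only [hc₀ u v h]
    ring
  have h0 : (colorClass c 0).card = 1 := by
    rw [← hi₀]
    congr 1
    ext v
    simp [mem_colorClass, hc_def, sub_eq_zero]
  obtain ⟨hT, hsum, hcard⟩ := prod_card_colorClass h0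
  rw [hc.numDicycles_eq_card hG'] at hN
  have hle1 := Finset.card_filter_le (transversals c) G.cyclicPart.IsCyclicTuple
  have hle2 := prod_le_prod_range_add_div (by omega) hcard hsum (by omega)
  have hprod : ∏ i ∈ Finset.univ.erase (0 : ZMod k), (colorClass c i).card =
      ∏ i ∈ Finset.range (k - 1), (Fintype.card V - 1 + i) / (k - 1) := by omega
  -- The number of cycles is at most the number of transversals, itself at most the bound, so every
  -- transversal is cyclic.
  have hall : ∀ x ∈ transversals c, G.cyclicPart.IsCyclicTuple x :=
    Finset.card_filter_eq_iff.1 (by omega)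
  have hfpos : 0 < ∏ i ∈ Finset.range (k - 1), (Fintype.card V - 1 + i) / (k - 1) :=
    Finset.prod_pos fun i _ => Nat.div_pos (by omega) (by omega)
  obtain ⟨x, hx⟩ : (transversals c).Nonempty := by
    rw [← Finset.card_pos, hT, hprod]
    exact hfpos
  have hpair : ∀ u v, c u ≠ c v → ∃ y, G.cyclicPart.IsCyclicTuple y ∧ y (c u) = u ∧ y (c v) = v := by
    intro u v huv
    refine ⟨Function.update (Function.update x (c u) u) (c v) v, hall _
      (update_mem_transversals (update_mem_transversals hx rfl) rfl), ?_, ?_⟩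
    · simp [huv]
    · simp
  have hadj : ∀ u v, c v = c u + 1 → G.cyclicPart.Adj u v := by
    intro u v h
    obtain ⟨y, hy, hyu, hyv⟩ := hpair u v (by rw [h]; simp)
    have := hy (c u)
    rwa [hyu, ← h, hyv] at this
  have hwalk' : ∀ u v, c u ≠ c v → ∃ n, G.HasWalk n u v := by
    intro u v h
    obtain ⟨y, hy, hyu, hyv⟩ := hpair u v h
    rw [← hyu, ← hyv]
    exact hasWalk_of_zmod (fun i => (hy i).1) _ _
  -- Strong connectivity puts every arc of `G` into `cyclicPart`, so no further arcs exist outside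
  -- the grading.
  have hwalk : ∀ u v, ∃ n, G.HasWalk n u v := by
    intro u v
    by_cases h : c u = c v
    · have h1 : c (x (c u + 1)) = c u + 1 := mem_transversals.1 hx _
      obtain ⟨n, hn⟩ := hwalk' (x (c u + 1)) v (by rw [h1, h]; simp)
      exact ⟨_, (HasWalk.of_adj (hadj _ _ h1).1).trans hn⟩
    · exact hwalk' u v h
  refine ⟨c, ?_, ?_, fun u v => ⟨fun h => hc u v ⟨h, hwalk v u⟩, fun h => (hadj u v h).1⟩⟩
  · rw [ncard_colorClass, h0]
  · intro i hi
    rw [ncard_colorClass]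
    exact (prod_eq_prod_range_add_div_iff (by omega) hcard hsum (by omega)).1 hprod i
      (Finset.mem_erase.2 ⟨hi, Finset.mem_univ _⟩)

/-- The colouring makes `k` divide the length. Conversely, a cycle meets class 0 at positions
differing by `k`, and since that class is one vertex, the length divides `k`. -/
theorem IsBalancedBlowup.isLCycleDigraph {G : Digraph V} (hk : 2 ≤ k)
    (hG : G.IsBalancedBlowup k) : G.IsLCycleDigraph {k} := by
  have : Fact (1 < k) := ⟨by omega⟩
  obtain ⟨c, h0, -, hadj⟩ := hG
  refine ⟨fun v h => by simpa using (hadj v v).1 h, fun C hC => ?_⟩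
  obtain ⟨hm, f, hf, hfa, -⟩ := hC.exists_eq_cycleOfFn
  have key : ∀ n : ℕ, c (f (n : ZMod C.length)) = c (f 0) + n := by
    intro n
    induction n with
    | zero => simp
    | succ n ih =>
      have := (hadj _ _).1 (hfa n)
      push_cast
      rw [this, ih, add_assoc]
  have h1 : k ∣ C.length := by
    have := key C.length
    rw [ZMod.natCast_self] at this
    rw [← ZMod.natCast_eq_zero_iff]
    simpa using this.symm
  have h2 : C.length ∣ k := by
    have : NeZero k := ⟨by omega⟩
    obtain ⟨r, hr⟩ := Set.ncard_eq_one.1 h0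
    have hmem : ∀ v, c v = 0 → v = r := fun v hv => by
      have : v ∈ {v | c v = 0} := hv
      rwa [hr] at this
    have ha := hmem _ ((key (-c (f 0)).val).trans (by simp))
    have hb := hmem _ ((key ((-c (f 0)).val + k)).trans (by simp))
    have := hf (ha.trans hb.symm)
    rw [← ZMod.natCast_eq_zero_iff]
    push_cast at this
    simpa using this.symm
  exact Nat.dvd_antisymm h2 h1

theorem IsBalancedBlowup.numDicycles_eq {G : Digraph V} (hk : 2 ≤ k) (hn : k ≤ Fintype.card V)
    (hG : G.IsBalancedBlowup k) :
    G.numDicycles = ∏ i ∈ Finset.range (k - 1), (Fintype.card V - 1 + i) / (k - 1) := by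
  classical
  have : NeZero k := ⟨by omega⟩
  have hL := hG.isLCycleDigraph hk
  obtain ⟨c, h0, hb, hadj⟩ := hG
  have hc : G.IsGraded c := fun u v => (hadj u v).1
  rw [ncard_colorClass] at h0
  obtain ⟨hT, hsum, hcard⟩ := prod_card_colorClass h0
  rw [hc.numDicycles_eq_card hL.2, Finset.filter_true_of_mem, hT]
  · refine (prod_eq_prod_range_add_div_iff (by omega) hcard hsum (by omega)).2 fun i hi => ?_
    rw [← ncard_colorClass]
    exact hb i (Finset.ne_of_mem_erase hi)
  · intro x hx i
    rw [hadj, mem_transversals.1 hx, mem_transversals.1 hx]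

end Digraph

/-! ### Existence of balanced blow-ups and the value of the maximum. -/

namespace Digraph

theorem exists_isBalancedBlowup {k n : ℕ} (hk : 2 ≤ k) (hkn : k ≤ n) :
    ∃ G : Digraph (Fin n), G.IsBalancedBlowup k := by
  have : NeZero n := ⟨by omega⟩
  have : NeZero k := ⟨by omega⟩
  -- Vertex 0 forms class 0; the others are dealt in turn to the classes `1, …, k - 1`.
  let c : Fin n → ZMod k := fun v => if v = 0 then 0 else (((v.val - 1) % (k - 1) + 1 : ℕ) : ZMod k)
  have hmod : ∀ v : ℕ, v % (k - 1) < k - 1 := fun v => Nat.mod_lt _ (by omega)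
  have hc : ∀ v, v ≠ 0 → (c v).val = (v.val - 1) % (k - 1) + 1 := fun v hv => by
    simp only [c, hv, if_false]
    rw [ZMod.val_natCast, Nat.mod_eq_of_lt]
    have := hmod (v.val - 1)
    omega
  have hc0 : c 0 = 0 := by simp [c]
  refine ⟨⟨fun u v => c v = c u + 1⟩, c, ?_, ?_, fun _ _ => Iff.rfl⟩
  · rw [Set.ncard_eq_one]
    refine ⟨0, Set.ext fun v => ⟨fun h => ?_, fun h => ?_⟩⟩
    · by_contra hv
      have h' : c v = 0 := h
      have := hc v hv
      rw [h', ZMod.val_zero] at this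
      omega
    · have h' : v = 0 := h
      rw [h']
      exact hc0
  · intro i hi
    have hi0 : i.val ≠ 0 := by rwa [Ne, ZMod.val_eq_zero]
    have hik := ZMod.val_lt i
    have hcount : {v | c v = i}.ncard = (n - 1).count (· ≡ i.val - 1 [MOD k - 1]) := by
      rw [Nat.count_eq_card_filter_range, ← Set.ncard_coe_finset]
      have hmem : ∀ v, c v = i → v ≠ 0 := fun v hv h => hi (by rw [← hv, h, hc0])
      refine Set.ncard_congr (fun v _ => v.val - 1) ?_ ?_ ?_
      · intro v hv
        have hv' : c v = i := hv
        have h1 := hc v (hmem v hv')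
        have h2 : v.val ≠ 0 := fun h => hmem v hv' (Fin.ext h)
        have := v.2
        simp only [Finset.coe_filter, Finset.mem_range]
        refine ⟨by omega, ?_⟩
        rw [Nat.ModEq, ← hv', h1, Nat.add_sub_cancel, Nat.mod_mod]
      · intro v w hv hw h
        have h2 : v.val ≠ 0 := fun h => hmem v hv (Fin.ext h)
        have h3 : w.val ≠ 0 := fun h => hmem w hw (Fin.ext h)
        exact Fin.ext (by omega)
      · intro x hx
        simp only [Finset.coe_filter, Finset.mem_range] at hx
        obtain ⟨hx1, hx2⟩ := hx
        have hne : (⟨x + 1, by omega⟩ : Fin n) ≠ 0 := fun h => by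
          have := congrArg Fin.val h
          simp at this
        refine ⟨⟨x + 1, by omega⟩, ?_, by simp⟩
        apply ZMod.val_injective k
        rw [hc _ hne]
        simp only [Nat.add_sub_cancel]
        rw [hx2, Nat.mod_eq_of_lt (by omega)]
        omega
    rw [hcount, Nat.count_modEq_card _ (by omega), Fintype.card_fin, ceilDiv_eq_ite (by omega)]
    split_ifs <;> omega

theorem maxDicycles_singleton {k n : ℕ} (hk : 2 ≤ k) (hkn : k ≤ n) :
    maxDicycles {k} n = ∏ i ∈ Finset.range (k - 1), (n - 1 + i) / (k - 1) := by
  have hmax := isGreatest_maxDicycles {k} n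
  apply le_antisymm
  · obtain ⟨G, hG, h⟩ := hmax.1
    rw [← h]
    simpa using numDicycles_le hk (by simpa using hkn) hG
  · obtain ⟨G, hG⟩ := exists_isBalancedBlowup hk hkn
    refine hmax.2 ⟨G, hG.isLCycleDigraph hk, ?_⟩
    simpa using hG.numDicycles_eq hk (by simpa using hkn)

/-! ### The case `k = 2`. -/

section digons

variable {V : Type*}

/-- The graph whose edges are the pairs of opposite arcs. -/
def digonGraph (G : Digraph V) : SimpleGraph V where
  Adj u v := u ≠ v ∧ G.Adj u v ∧ G.Adj v u
  symm := ⟨fun _ _ h => ⟨h.1.symm, h.2.2, h.2.1⟩⟩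
  loopless := ⟨fun _ h => h.1 rfl⟩

theorem IsLCycleDigraph.isAcyclic_digonGraph {G : Digraph V} (hG : G.IsLCycleDigraph {2}) :
    G.digonGraph.IsAcyclic := by
  rw [SimpleGraph.isAcyclic_iff_free_cycleGraph]
  rintro n hn ⟨F⟩
  obtain ⟨m, rfl⟩ := Nat.exists_eq_add_of_le' hn
  obtain ⟨f, hf⟩ := F
  -- `ZMod (m + 3)` unfolds to `Fin (m + 3)`, so the embedded cycle is already a parametrized
  -- directed cycle.
  let g : ZMod (m + 3) → V := f
  have hd : G.IsDicycle (cycleOfFn g) := by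
    refine isDicycle_cycleOfFn G hf fun i => ?_
    exact (f.map_rel' (SimpleGraph.cycleGraph_adj.2 (Or.inr (add_sub_cancel_left i 1)))).2.1
  have := hG.2 _ hd
  rw [length_cycleOfFn, Set.mem_singleton_iff] at this
  omega

/-- A cyclic transversal for `k = 2` is a pair of opposite arcs listed with its vertex of colour 0
first, hence an edge of `digonGraph`. -/
theorem IsLCycleDigraph.numDicycles_eq_ncard_edgeSet [Fintype V] {G : Digraph V}
    (hG : G.IsLCycleDigraph {2}) : G.numDicycles = G.digonGraph.edgeSet.ncard := by
  obtain ⟨c, hc⟩ := exists_isGraded_cyclicPart hG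
  rw [← numDicycles_cyclicPart, numDicycles_eq_ncard_isCyclicTransversal hc hG.cyclicPart.2]
  have h11 : (1 : ZMod 2) + 1 = 0 := rfl
  refine Set.ncard_congr (fun x _ => s(x 0, x 1)) ?_ ?_ ?_
  · intro x hx
    have hx : G.cyclicPart.IsCyclicTransversal c x := hx
    refine ⟨fun h => absurd (hx.injective h) (by decide), ?_, ?_⟩
    · simpa using (hx.2 0).1
    · simpa [h11] using (hx.2 1).1
  · intro x y hx hy h
    have hx : G.cyclicPart.IsCyclicTransversal c x := hx
    have hy : G.cyclicPart.IsCyclicTransversal c y := hy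
    rw [Sym2.eq_iff] at h
    rcases h with h | h
    · funext i
      fin_cases i
      · exact h.1
      · exact h.2
    · have := hx.1 0
      rw [h.1, hy.1] at this
      exact absurd this (by decide)
  · intro e he
    induction e using Sym2.ind with
    | _ u v =>
      obtain ⟨-, huv, hvu⟩ := he
      have huv' : G.cyclicPart.Adj u v := ⟨huv, 1, .of_adj hvu⟩
      have hvu' : G.cyclicPart.Adj v u := ⟨hvu, 1, .of_adj huv⟩
      have key : ∀ a b, c a = 0 → G.cyclicPart.Adj a b → G.cyclicPart.Adj b a →
          G.cyclicPart.IsCyclicTransversal c (fun i : ZMod 2 => if i = 0 then a else b) := by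
        intro a b ha hab hba
        have hb := hc a b hab
        rw [ha, zero_add] at hb
        refine ⟨fun i => ?_, fun i => ?_⟩ <;> fin_cases i
        · exact ha
        · exact hb
        · exact hab
        · exact hba
      have h2 : ∀ i : ZMod 2, i = 0 ∨ i = 1 := by decide
      rcases h2 (c u) with h | h
      · exact ⟨_, key u v h huv' hvu', by simp⟩
      · refine ⟨_, key v u ?_ hvu' huv', by simp [Sym2.eq_swap]⟩
        rw [hc u v huv', h, h11]

theorem isDicycle_support {G : Digraph V} {T : SimpleGraph V} (hT : ∀ u v, T.Adj u v → G.Adj u v)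
    {u v : V} {p : T.Walk v u} (hp : p.IsPath) (h : G.Adj u v) :
    G.IsDicycle (p.support : List V) := by
  refine ⟨by simp, by simpa using hp.support_nodup, ?_⟩
  have hs : p.support = v :: p.support.tail := p.cons_tail_support.symm
  have hch := p.isChain_adj_support.imp hT
  have hlast : p.support.getLast? = some u := by
    rw [List.getLast?_eq_some_getLast p.support_ne_nil, SimpleGraph.Walk.getLast_support]
  rw [hs, Cycle.chain_coe_cons, ← List.cons_append, ← hs, List.isChain_append]
  refine ⟨hch, by simp, ?_⟩
  rw [hlast]
  simpa using h

theorem isDoubledTree_iff [Fintype V] {G : Digraph V} (hV : 2 ≤ Fintype.card V) :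
    G.IsLCycleDigraph {2} ∧ G.numDicycles = Fintype.card V - 1 ↔ G.IsDoubledTree := by
  have hne : Nonempty V := Fintype.card_pos_iff.1 (by omega)
  constructor
  · rintro ⟨hG, hN⟩
    rw [hG.numDicycles_eq_ncard_edgeSet] at hN
    have hT := hG.isAcyclic_digonGraph.ncard_edgeSet_add_one_le.2
      (by rw [Nat.card_eq_fintype_card]; omega)
    refine ⟨G.digonGraph, hT, fun u v => ⟨fun h => ?_, fun h => h.2.1⟩⟩
    -- An arc from `u` to `v` closes the tree path from `v` to `u` to a directed cycle; its length
    -- is 2, so the path is a single edge.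
    obtain ⟨p, hp⟩ := hT.connected.preconnected.exists_isPath v u
    have := hG.2 _ (isDicycle_support (T := G.digonGraph) (fun _ _ h => h.2.1) hp h)
    rw [Cycle.length_coe, SimpleGraph.Walk.length_support, Set.mem_singleton_iff] at this
    exact (SimpleGraph.Walk.adj_of_length_eq_one (p := p) (by omega)).symm
  · rintro ⟨T, hT, hadj⟩
    have hG : G.IsLCycleDigraph {2} := by
      refine ⟨fun v h => T.loopless.irrefl v ((hadj v v).1 h), fun C hC => ?_⟩
      obtain ⟨h0, f, hf, hfa, -⟩ := hC.exists_eq_cycleOfFn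
      by_contra hlen
      rw [Set.mem_singleton_iff] at hlen
      revert h0 f hlen
      generalize C.length = m
      intro h0 f hf hfa hm
      match m, h0, hm with
      | 1, _, _ =>
        have := hfa 0
        rw [show (0 : ZMod 1) + 1 = 0 from rfl, hadj] at this
        exact T.loopless.irrefl _ this
      | m + 3, _, _ =>
        refine SimpleGraph.isAcyclic_iff_free_cycleGraph.1 hT.isAcyclic (m + 3) (by omega)
          ⟨⟨⟨f, ?_⟩, hf⟩⟩
        intro a b hab
        have hstep : ∀ a b : ZMod (m + 3), b - a = 1 → T.Adj (f a) (f b) := fun a b h => by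
          rw [sub_eq_iff_eq_add'.1 h]
          exact (hadj _ _).1 (hfa a)
        rw [SimpleGraph.cycleGraph_adj] at hab
        rcases hab with h | h
        · exact (hstep b a h).symm
        · exact hstep a b h
    refine ⟨hG, ?_⟩
    have hTG : G.digonGraph = T := by
      ext u v
      refine ⟨fun h => (hadj _ _).1 h.2.1, fun h => ⟨h.ne, (hadj _ _).2 h, (hadj _ _).2 h.symm⟩⟩
    have := (SimpleGraph.isTree_iff_connected_and_card.1 hT).2
    rw [Nat.card_coe_set_eq, Nat.card_eq_fintype_card] at this
    rw [hG.numDicycles_eq_ncard_edgeSet, hTG]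
    omega

end digons

end Digraph

theorem theorem5 (k n : ℕ) (hk : 2 ≤ k) (hkn : k ≤ n) :
    maxDicycles {k} n = ∏ i ∈ Finset.range (k - 1), (n - 1 + i) / (k - 1) ∧
    (3 ≤ k → ∀ (V : Type*) [Fintype V], Fintype.card V = n →
      ∀ G : Digraph V, G.IsExtremal {k} ↔ G.IsBalancedBlowup k) ∧
    (k = 2 → ∀ (V : Type*) [Fintype V], Fintype.card V = n →
      ∀ G : Digraph V, G.IsExtremal {k} ↔ G.IsDoubledTree) := by
  refine ⟨Digraph.maxDicycles_singleton hk hkn, ?_, ?_⟩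
  · rintro hk3 V _ rfl G
    rw [Digraph.IsExtremal, Digraph.maxDicycles_singleton hk hkn]
    exact ⟨fun h => Digraph.isBalancedBlowup_of_numDicycles_eq hk3 hkn h.1 h.2,
      fun h => ⟨h.isLCycleDigraph hk, h.numDicycles_eq hk hkn⟩⟩
  · rintro rfl V _ rfl G
    rw [Digraph.IsExtremal, Digraph.maxDicycles_singleton hk hkn, ← Digraph.isDoubledTree_iff hkn]
    simp
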